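/- **Theorem.** All digraphs are finite. For $k\ge 1$ vertex-disjoint digraphs $G_1,\dots,G_k$, the disjoint union $G_1\oplus\cdots\oplus G_k$ has as vertices and arcs those of the $G_i$; the order composition $G_1\oslash\cdots\oslash G_k$ has in addition all arcs from vertices of $G_i$ to vertices of $G_j$ for $1\le i<j\le k$. *Oriented co-graphs* are the digraphs obtained from single vertices (without arcs) by these two operations. An *oriented $k$-coloring* of an oriented graph $G=(V,A)$ is a map $c:V\to\{1,\dots,k\}$ such that $c(u)\ne c(v)$ for every $(u,v)\in A$, and $c(u)\neq c(y)$ for all $(u,v),(x,y)\in A$ with $c(v)=c(x)$; the *oriented chromatic number* $\chi_o(G)$ is the smallest $k$ for which such a coloring exists. 1. An optimal oriented coloring and $\chi_o(G)$ can be computed in linear time for oriented co-graphs $G$. That is, there are a program for the unit-cost random access machine (with assignment, addition, truncated subtraction, indirect load and store, and comparison of natural numbers) and a constant $C$ such that, for every oriented co-graph $G$ with vertex set $\{0,\dots,n-1\}$ and $m$ arcs, given by $n$, $m$ and a list of its arcs in any order, the program halts after at most $C(n+m)$ steps, uses no number larger than $C(n+m)$, and outputs $\chi_o(G)$ and an oriented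 $\chi_o(G)$-coloring of $G$. 2. A *di-co-tree* for $G$ is a rooted ordered tree whose leaves are the vertices of $G$ and whose inner nodes, each with at least two children, are labelled $\oplus$ or $\oslash$, such that evaluating the expression it represents gives $G$; it is *canonical* if the two labels strictly alternate on every path from the root to a leaf. Every oriented co-graph $G$ has a canonical di-co-tree. For every canonical di-co-tree $T$ of $G$ with root $r$, the following algorithm, called as $\mathrm{Label}(r,1)$, returns $\chi_o(G)$, leaves in the array $\mathrm{color}$ (whatever its initial contents) an oriented $\chi_o(G)$-coloring of $G$, and takes at most $C'|V|$ steps, where $C'$ is an absolute constant and each assignment, test, return and loop iteration counts as one step. $\mathrm{Label}(u,i)$: If $u$ is a leaf, set $\mathrm{color}[u]=\mathrm{in}[u]=\mathrm{out}[u]=i$. Otherwise set $\mathrm{in}[u]=i$, $\mathrm{out}[u]=0$ and, for the children $v$ of $u$ from left to right: set $j=\mathrm{Label}(v,i)$; if $\mathrm{out}[u]<j$, set $\mathrm{out}[u]=j$; then set $i=\mathrm{in}[u]$ if $u$ is labelled $\oplus$, and $i=\mathrm{out}[v]+1$ if $u$ is labelled $\oslash$. Return $\mathrm{out}[u]$.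 -/

import Mathlib

namespace OCG

/-! Digraphs and the composition operations.

`VDigraph V` is a digraph whose vertex set is a subset of `V`; it is used for the pieces from which
a digraph on the whole of `V` is composed. -/

/-- A digraph with vertex set `verts ⊆ V` and arc relation `arc`. -/
@[ext]
structure VDigraph (V : Type*) where
  verts : Set V
  arc : V → V → Prop

namespace VDigraph

variable {V : Type*}

/-- The digraph with the single vertex `v` and no arc. -/
def single (v : V) : VDigraph V where
  verts := {v}
  arc := fun _ _ => False

/-- The family `F 0, …, F (k-1)` is (pairwise) vertex-disjoint. -/
def VertexDisjoint {k : ℕ} (F : Fin k → VDigraph V) : Prop :=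
  ∀ i j : Fin k, i ≠ j → Disjoint (F i).verts (F j).verts

/-- The disjoint union `F 0 ⊕ ⋯ ⊕ F (k-1)`. -/
def disjointUnion {k : ℕ} (F : Fin k → VDigraph V) : VDigraph V where
  verts := ⋃ i, (F i).verts
  arc := fun u v => ∃ i, (F i).arc u v

/-- The order composition `F 0 ⊘ ⋯ ⊘ F (k-1)`: the disjoint union plus all arcs from the vertices
of `F i` to the vertices of `F j` for `i < j`. -/
def orderComposition {k : ℕ} (F : Fin k → VDigraph V) : VDigraph V where
  verts := ⋃ i, (F i).verts
  arc := fun u v => (∃ i, (F i).arc u v) ∨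
    ∃ i j : Fin k, i < j ∧ u ∈ (F i).verts ∧ v ∈ (F j).verts

/-- A digraph on the vertex type `V`, as a digraph whose vertex set is all of `V`. -/
def ofDigraph (G : Digraph V) : VDigraph V where
  verts := Set.univ
  arc := G.Adj

/-- The recursively defined class of oriented co-graphs. -/
inductive IsOrientedCograph : VDigraph V → Prop
  | single (v : V) : IsOrientedCograph (single v)
  | disjointUnion {k : ℕ} (hk : 1 ≤ k) (F : Fin k → VDigraph V) (hd : VertexDisjoint F)
      (hF : ∀ i, IsOrientedCograph (F i)) : IsOrientedCograph (disjointUnion F)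
  | orderComposition {k : ℕ} (hk : 1 ≤ k) (F : Fin k → VDigraph V) (hd : VertexDisjoint F)
      (hF : ∀ i, IsOrientedCograph (F i)) : IsOrientedCograph (orderComposition F)

end VDigraph

/-- The digraph `G` is an oriented co-graph. -/
def IsOrientedCograph {V : Type*} (G : Digraph V) : Prop :=
  (VDigraph.ofDigraph G).IsOrientedCograph

/-! Oriented colorings. -/

/-- `c` is an oriented `k`-coloring of `G` (with colors `1, …, k`). -/
def IsOrientedColoring {V : Type*} (G : Digraph V) (k : ℕ) (c : V → ℕ) : Prop :=
  (∀ v, 1 ≤ c v ∧ c v ≤ k) ∧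
  (∀ u v, G.Adj u v → c u ≠ c v) ∧
  (∀ u v x y, G.Adj u v → G.Adj x y → c v = c x → c u ≠ c y)

/-- The oriented chromatic number: the smallest `k` such that `G` has an oriented `k`-coloring. -/
noncomputable def orientedChromaticNumber {V : Type*} (G : Digraph V) : ℕ :=
  sInf {k | ∃ c : V → ℕ, IsOrientedColoring G k c}

/-! Di-co-trees and the algorithm Label. -/

/-- The two operations that may label an inner node of the di-co-tree of an oriented co-graph. -/
inductive Op
  | union
  | order

/-- Rooted trees with leaves labelled by elements of `V`, and inner nodes labelled by operations;
an inner node has `k + 2 ≥ 2` children, ordered from left to right. -/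
inductive DiCoTree (V : Type*)
  | leaf (v : V) : DiCoTree V
  | node (op : Op) (k : ℕ) (child : Fin (k + 2) → DiCoTree V) : DiCoTree V

namespace DiCoTree

variable {V : Type*}

/-- The digraph defined by a tree. -/
def digraph : DiCoTree V → VDigraph V
  | leaf v => VDigraph.single v
  | node Op.union _ child => VDigraph.disjointUnion fun j => (child j).digraph
  | node Op.order _ child => VDigraph.orderComposition fun j => (child j).digraph

/-- At every inner node, the digraphs defined by the children are vertex-disjoint. -/
def IsVertexDisjoint : DiCoTree V → Prop
  | leaf _ => True
  | node _ _ child =>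
      VDigraph.VertexDisjoint (fun j => (child j).digraph) ∧ ∀ j, (child j).IsVertexDisjoint

/-- `T` is a di-co-tree for `G`. -/
def IsDiCoTreeOf (T : DiCoTree V) (G : Digraph V) : Prop :=
  T.IsVertexDisjoint ∧ T.digraph = VDigraph.ofDigraph G

/-- The operation at the root, if the root is an inner node. -/
def rootOp : DiCoTree V → Option Op
  | leaf _ => none
  | node op _ _ => some op

/-- The two operations strictly alternate on every path from the root to a leaf. -/
def IsCanonical : DiCoTree V → Prop
  | leaf _ => True
  | node op _ child => ∀ j, (child j).rootOp ≠ some op ∧ (child j).IsCanonical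

/-- Result of a call of Label: the returned value `out[u]`, the contents of the array `color`
(indexed by the vertices of the graph, that is, by the leaves), and the number of steps. -/
structure LabelResult (V : Type*) where
  out : ℕ
  color : V → ℕ
  steps : ℕ

/-- Local variables of the loop of Label over the children of an inner node: the current values of
`i`, of `out[u]`, of the array `color`, and the number of steps so far. -/
structure LoopState (V : Type*) where
  i : ℕ
  out : ℕ
  color : V → ℕ
  steps : ℕ

/-- Algorithm Label on the tree rooted at `u`, called with the value `i` (which becomes `in[u]`)
and the current contents of the array `color`:

  if `u` is a leaf: `color[u] = i; in[u] = i; out[u] = i`;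
  otherwise: `in[u] = i; out[u] = 0`, and for all children `v` of `u` from left to right:
    `j = Label(v, i)`; if `out[u] < j` then `out[u] = j`;
    `i = in[u]` if `u` is a disjoint union, and `i = out[v] + 1` if `u` is an order operation;
  return `out[u]`.

Every assignment, test, return, and iteration of the loop counts as one step:
`5 = 1 + 3 + 1` for a leaf, `4 = 1 + 2 + 1` for an inner node, and at most
`6 = 1 + 1 + 1 + 1 + 1 + 1` for each child, besides the recursive call. -/
def label [DecidableEq V] : DiCoTree V → ℕ → (V → ℕ) → LabelResult V
  | leaf v, i, color => ⟨i, Function.update color v i, 5⟩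
  | node op k child, i, color =>
      let fin := Fin.foldl (k + 2)
        (fun (s : LoopState V) (v : Fin (k + 2)) =>
          let r := label (child v) s.i s.color
          { i := match op with
              | Op.union => i
              | Op.order => r.out + 1
            out := if s.out < r.out then r.out else s.out
            color := r.color
            steps := s.steps + r.steps + 6 })
        ⟨i, 0, color, 4⟩
      ⟨fin.out, fin.color, fin.steps⟩

end DiCoTree

/-! A random access machine with unit-cost instructions, presented by structured programs. -/

/-- State of the machine: registers and memory cells, holding natural numbers. -/
structure State where
  reg : ℕ → ℕ
  mem : ℕ → ℕ

/-- The state after writing `x` into register `r`. -/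
def State.setReg (s : State) (r x : ℕ) : State :=
  { s with reg := Function.update s.reg r x }

/-- The state after writing `x` into memory cell `a`. -/
def State.setMem (s : State) (a x : ℕ) : State :=
  { s with mem := Function.update s.mem a x }

/-- Programs. A program mentions only finitely many registers; the memory is accessed only by
indirect addressing through registers. -/
inductive Program
  /-- `r := k` -/
  | const (r k : ℕ) : Program
  /-- `r := a` -/
  | copy (r a : ℕ) : Program
  /-- `r := a + b` -/
  | add (r a b : ℕ) : Program
  /-- `r := a - b`, truncated at `0` -/
  | sub (r a b : ℕ) : Program
  /-- `r := mem[a]` -/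
  | load (r a : ℕ) : Program
  /-- `mem[a] := r` -/
  | store (a r : ℕ) : Program
  /-- `p; q` -/
  | seq (p q : Program) : Program
  /-- `if a < b then p else q` -/
  | ifLt (a b : ℕ) (p q : Program) : Program
  /-- `while a < b do p` -/
  | whileLt (a b : ℕ) (p : Program) : Program

/-- `Exec W p s s' t`: on a machine whose words are the numbers `0, …, W`, program `p` started in
state `s` halts in state `s'` after exactly `t` steps, and no value that it computes exceeds `W`.
Every elementary instruction and every test takes one step. -/
inductive Exec (W : ℕ) : Program → State → State → ℕ → Prop
  | const (s : State) (r k : ℕ) (h : k ≤ W) :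
      Exec W (.const r k) s (s.setReg r k) 1
  | copy (s : State) (r a : ℕ) :
      Exec W (.copy r a) s (s.setReg r (s.reg a)) 1
  | add (s : State) (r a b : ℕ) (h : s.reg a + s.reg b ≤ W) :
      Exec W (.add r a b) s (s.setReg r (s.reg a + s.reg b)) 1
  | sub (s : State) (r a b : ℕ) :
      Exec W (.sub r a b) s (s.setReg r (s.reg a - s.reg b)) 1
  | load (s : State) (r a : ℕ) :
      Exec W (.load r a) s (s.setReg r (s.mem (s.reg a))) 1
  | store (s : State) (a r : ℕ) :
      Exec W (.store a r) s (s.setMem (s.reg a) (s.reg r)) 1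
  | seq {p q : Program} {s s' s'' : State} {t t' : ℕ} (hp : Exec W p s s' t)
      (hq : Exec W q s' s'' t') : Exec W (.seq p q) s s'' (t + t')
  | ifLt_true {a b : ℕ} {p q : Program} {s s' : State} {t : ℕ} (h : s.reg a < s.reg b)
      (hp : Exec W p s s' t) : Exec W (.ifLt a b p q) s s' (t + 1)
  | ifLt_false {a b : ℕ} {p q : Program} {s s' : State} {t : ℕ} (h : ¬ s.reg a < s.reg b)
      (hq : Exec W q s s' t) : Exec W (.ifLt a b p q) s s' (t + 1)
  | while_true {a b : ℕ} {p : Program} {s s' s'' : State} {t t' : ℕ} (h : s.reg a < s.reg b)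
      (hp : Exec W p s s' t) (hw : Exec W (.whileLt a b p) s' s'' t') :
      Exec W (.whileLt a b p) s s'' (t + t' + 1)
  | while_false {a b : ℕ} {p : Program} {s : State} (h : ¬ s.reg a < s.reg b) :
      Exec W (.whileLt a b p) s s 1

/-- The words that encode a digraph with `n` vertices `0, …, n-1` whose arcs are listed in `L`:
`n`, the number of arcs, and then tail and head of each arc in turn. -/
def encodeInput {n : ℕ} (L : List (Fin n × Fin n)) : List ℕ :=
  n :: L.length :: L.flatMap fun e => [(e.1 : ℕ), (e.2 : ℕ)]

/-- The initial state: the memory holds the encoding of the digraph from cell `0` on; all other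
cells and all registers are `0`. -/
def inputState {n : ℕ} (L : List (Fin n × Fin n)) : State where
  reg := fun _ => 0
  mem := fun a => (encodeInput L).getD a 0

/-- `L` lists every arc of `G` exactly once (in some order). -/
def ListsArcs {n : ℕ} (G : Digraph (Fin n)) (L : List (Fin n × Fin n)) : Prop :=
  L.Nodup ∧ ∀ u v, (u, v) ∈ L ↔ G.Adj u v

/-- Within `B` steps and with words at most `B`, program `P` computes from the arc list `L` the
oriented chromatic number of `G` (in register `0`) and an oriented coloring of `G` with that many
colors (the color of vertex `v` stands in the memory cell whose address is `v` plus the content of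
register `1`). -/
def ComputesOptimalColoring {n : ℕ} (P : Program) (G : Digraph (Fin n))
    (L : List (Fin n × Fin n)) (B : ℕ) : Prop :=
  ∃ (s : State) (t : ℕ), Exec B P (inputState L) s t ∧ t ≤ B ∧
    s.reg 0 = orientedChromaticNumber G ∧
    IsOrientedColoring G (orientedChromaticNumber G) fun v => s.mem (s.reg 1 + (v : ℕ))

end OCG

namespace OCG

variable {V : Type*}

/-! Order-theoretic structure and the clique bound. -/

namespace VDigraph

/-! The arcs of an oriented co-graph form a strict partial order: both operations preserve
irreflexivity and transitivity. A map that strictly increases along arcs is an oriented coloring,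
and a set of pairwise adjacent vertices needs pairwise distinct colors. So an increasing coloring
and a clique of equal size certify each other's optimality (`orientedChromaticNumber_eq`), and both
algorithms are shown to produce such a pair.

Label colors the leaves below a node increasingly with colors from an interval `[i, out]`, while a
clique of `out - i + 1` vertices exists there (`label_spec`). Under a union all children start at
the same `i`, and the largest clique survives; under an order composition each child starts just
above the previous one, and the cliques add up. Canonical trees arise by flattening: both operations
are associative, so a child whose root carries the parent's label can be replaced by its own
children.

The machine program needs no tree. By transitivity and irreflexivity the in-degree strictly
increases along every arc. The program bucket-sorts the arcs by the in-degree of the tail and, in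
that order, raises the color of each head above that of its tail. When an arc is treated, its head
is not yet the tail of a treated arc, so earlier inequalities persist (`Relaxed.raise`). Each color
is the size of a clique ending at that vertex, so the largest color is optimal. -/

theorem IsOrientedCograph.mem_verts {D : VDigraph V} (h : D.IsOrientedCograph) :
    ∀ {u v : V}, D.arc u v → u ∈ D.verts ∧ v ∈ D.verts := by
  induction h with
  | single v => intro _ _ h; exact h.elim
  | disjointUnion hk F hd hF ih =>
    rintro u v ⟨i, h⟩
    exact ⟨Set.mem_iUnion.2 ⟨i, (ih i h).1⟩, Set.mem_iUnion.2 ⟨i, (ih i h).2⟩⟩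
  | orderComposition hk F hd hF ih =>
    rintro u v (⟨i, h⟩ | ⟨i, j, -, hu, hv⟩)
    · exact ⟨Set.mem_iUnion.2 ⟨i, (ih i h).1⟩, Set.mem_iUnion.2 ⟨i, (ih i h).2⟩⟩
    · exact ⟨Set.mem_iUnion.2 ⟨i, hu⟩, Set.mem_iUnion.2 ⟨j, hv⟩⟩

theorem VertexDisjoint.eq_of_mem {k : ℕ} {F : Fin k → VDigraph V} (h : VertexDisjoint F)
    {i j : Fin k} {u : V} (hi : u ∈ (F i).verts) (hj : u ∈ (F j).verts) : i = j := by
  by_contra hij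
  exact Set.disjoint_left.1 (h i j hij) hi hj

theorem IsOrientedCograph.irrefl {D : VDigraph V} (h : D.IsOrientedCograph) :
    ∀ u : V, ¬ D.arc u u := by
  induction h with
  | single v => intro _ h; exact h
  | disjointUnion hk F hd hF ih =>
    rintro u ⟨i, h⟩
    exact ih i u h
  | orderComposition hk F hd hF ih =>
    rintro u (⟨i, h⟩ | ⟨i, j, hij, hu, hv⟩)
    · exact ih i u h
    · exact hij.ne (hd.eq_of_mem hu hv)

/-- Disjointness places the middle vertex in a single part, so two consecutive arcs either stay
inside that part or one of them crosses to a later part, and then so does the composite. -/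
theorem IsOrientedCograph.trans {D : VDigraph V} (h : D.IsOrientedCograph) :
    ∀ {u v w : V}, D.arc u v → D.arc v w → D.arc u w := by
  induction h with
  | single v => intro _ _ _ h; exact h.elim
  | disjointUnion hk F hd hF ih =>
    rintro u v w ⟨i, h⟩ ⟨j, h'⟩
    obtain rfl := hd.eq_of_mem ((hF i).mem_verts h).2 ((hF j).mem_verts h').1
    exact ⟨i, ih i h h'⟩
  | orderComposition hk F hd hF ih =>
    rintro u v w (⟨i, h⟩ | ⟨i, j, hij, hu, hv⟩) (⟨i', h'⟩ | ⟨i', j', hij', hu', hv'⟩)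
    · obtain rfl := hd.eq_of_mem ((hF i).mem_verts h).2 ((hF i').mem_verts h').1
      exact .inl ⟨i, ih i h h'⟩
    · obtain rfl := hd.eq_of_mem ((hF i).mem_verts h).2 hu'
      exact .inr ⟨i, j', hij', ((hF i).mem_verts h).1, hv'⟩
    · obtain rfl := hd.eq_of_mem hv ((hF i').mem_verts h').1
      exact .inr ⟨i, j, hij, hu, ((hF j).mem_verts h').2⟩
    · obtain rfl := hd.eq_of_mem hv hu'
      exact .inr ⟨i, j', hij.trans hij', hu, hv'⟩

theorem IsOrientedCograph.nonempty {D : VDigraph V} (h : D.IsOrientedCograph) :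
    D.verts.Nonempty := by
  induction h with
  | single v => exact ⟨v, rfl⟩
  | disjointUnion hk F hd hF ih | orderComposition hk F hd hF ih =>
    obtain ⟨v, hv⟩ := ih ⟨0, hk⟩
    exact ⟨v, Set.mem_iUnion.2 ⟨_, hv⟩⟩

end VDigraph

/-- A violation of the second coloring condition would give `c u < c v = c x < c y = c u`. -/
theorem isOrientedColoring_of_strictMono {G : Digraph V} {k : ℕ} {c : V → ℕ}
    (hc : ∀ v, 1 ≤ c v ∧ c v ≤ k) (h : ∀ u v, G.Adj u v → c u < c v) :
    IsOrientedColoring G k c := by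
  refine ⟨hc, fun u v huv => (h u v huv).ne, fun u v x y huv hxy hvx => ?_⟩
  have := h u v huv
  have := h x y hxy
  omega

theorem IsOrientedColoring.card_le {G : Digraph V} {k : ℕ} {c : V → ℕ}
    (hc : IsOrientedColoring G k c) (S : Finset V)
    (hS : ∀ u ∈ S, ∀ v ∈ S, u ≠ v → G.Adj u v ∨ G.Adj v u) : S.card ≤ k := by
  have : S.card ≤ (Finset.Icc 1 k).card := by
    refine Finset.card_le_card_of_injOn c (fun v _ => Finset.mem_coe.2 (Finset.mem_Icc.2 (hc.1 v))) ?_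
    intro u hu v hv huv
    by_contra hne
    rcases hS u hu v hv hne with h | h
    · exact hc.2.1 u v h huv
    · exact hc.2.1 v u h huv.symm
  simpa using this

theorem orientedChromaticNumber_eq {G : Digraph V} {k : ℕ} {c : V → ℕ}
    (hc : IsOrientedColoring G k c) (S : Finset V) (hk : S.card = k)
    (hS : ∀ u ∈ S, ∀ v ∈ S, u ≠ v → G.Adj u v ∨ G.Adj v u) :
    orientedChromaticNumber G = k := by
  refine le_antisymm (Nat.sInf_le ⟨c, hc⟩) (le_csInf ⟨k, c, hc⟩ ?_)
  rintro l ⟨c', hc'⟩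
  exact hk ▸ hc'.card_le S hS

/-! Existence of canonical di-co-trees. -/

namespace VDigraph

/-- The composition of a finite family under either operation. -/
def compose (op : Op) {k : ℕ} (F : Fin k → VDigraph V) : VDigraph V :=
  match op with
  | Op.union => disjointUnion F
  | Op.order => orderComposition F

/-- The composition of two digraphs under either operation. -/
def binary (op : Op) (D E : VDigraph V) : VDigraph V where
  verts := D.verts ∪ E.verts
  arc := fun u v => D.arc u v ∨ E.arc u v ∨ (op = Op.order ∧ u ∈ D.verts ∧ v ∈ E.verts)

/-- The composition of a list of digraphs under either operation. -/
def listCompose (op : Op) (l : List (VDigraph V)) : VDigraph V :=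
  l.foldr (binary op) ⟨∅, fun _ _ => False⟩

/-- Lists replace indexed families because flattening is concatenation of lists, which
`listCompose_append` turns into composition. -/
theorem compose_eq_listCompose (op : Op) {k : ℕ} (F : Fin k → VDigraph V) :
    compose op F = listCompose op (List.ofFn F) := by
  induction k with
  | zero =>
    cases op <;> simp [compose, listCompose, disjointUnion, orderComposition]
  | succ k ih =>
    have ih := ih (fun i => F i.succ)
    rw [List.ofFn_succ, listCompose, List.foldr_cons]
    rw [listCompose] at ih
    rw [← ih]
    cases op <;> ext u v <;>
      simp [compose, binary, disjointUnion, orderComposition, Fin.exists_fin_succ]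
    grind

theorem binary_empty (op : Op) (D : VDigraph V) : binary op D ⟨∅, fun _ _ => False⟩ = D := by
  ext <;> simp [binary]

theorem empty_binary (op : Op) (D : VDigraph V) : binary op ⟨∅, fun _ _ => False⟩ D = D := by
  ext <;> simp [binary]

theorem binary_assoc (op : Op) (D E F : VDigraph V) :
    binary op (binary op D E) F = binary op D (binary op E F) := by
  ext <;> simp [binary] <;> tauto

theorem listCompose_append (op : Op) (l l' : List (VDigraph V)) :
    listCompose op (l ++ l') = binary op (listCompose op l) (listCompose op l') := by
  induction l with
  | nil => exact (empty_binary _ _).symm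
  | cons D l ih =>
    rw [listCompose] at ih
    simp only [listCompose, List.cons_append, List.foldr_cons, ih, binary_assoc]

theorem verts_listCompose (op : Op) (l : List (VDigraph V)) :
    (listCompose op l).verts = {v | ∃ D ∈ l, v ∈ D.verts} := by
  induction l with
  | nil => simp [listCompose]
  | cons D l ih =>
    rw [listCompose] at ih
    ext v
    simp [listCompose, binary, ih]

theorem pairwise_ofFn_iff {k : ℕ} (F : Fin k → VDigraph V) :
    (List.ofFn F).Pairwise (fun D E => Disjoint D.verts E.verts) ↔ VertexDisjoint F := by
  rw [List.pairwise_ofFn]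
  constructor
  · intro h i j hij
    rcases lt_or_gt_of_ne hij with h' | h'
    · exact h h'
    · exact (h h').symm
  · intro h i j hij
    exact h i j hij.ne

end VDigraph

namespace DiCoTree

open VDigraph

theorem digraph_node (op : Op) (k : ℕ) (child : Fin (k + 2) → DiCoTree V) :
    (node op k child).digraph = compose op fun j => (child j).digraph := by
  cases op <;> rfl

/-- `D` is the composition under `op` of a nonempty list of canonical trees, none of which has
`op` at its root. -/
def HasParts (op : Op) (D : VDigraph V) : Prop :=
  ∃ l : List (DiCoTree V), l ≠ [] ∧
    (∀ T ∈ l, T.IsVertexDisjoint ∧ T.IsCanonical ∧ T.rootOp ≠ some op) ∧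
    (l.map digraph).Pairwise (fun D E => Disjoint D.verts E.verts) ∧
    D = listCompose op (l.map digraph)

/-- `D` is defined by a canonical tree. -/
def HasCanonicalTree (D : VDigraph V) : Prop :=
  ∃ T : DiCoTree V, T.IsVertexDisjoint ∧ T.IsCanonical ∧ D = T.digraph

/-- If the root carries `op`, its children serve as the parts, and canonicity keeps `op` off their
roots; otherwise the tree itself is the only part. -/
theorem HasCanonicalTree.hasParts {D : VDigraph V} (h : HasCanonicalTree D) (op : Op) :
    HasParts op D := by
  obtain ⟨T, hT, hc, rfl⟩ := h
  by_cases hr : T.rootOp = some op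
  · cases T with
    | leaf v => cases hr
    | node op' k child =>
      obtain rfl : op' = op := by simpa [rootOp] using hr
      refine ⟨List.ofFn child, by simp, ?_, ?_, ?_⟩
      · intro T hT'
        obtain ⟨j, rfl⟩ := (List.mem_ofFn' _ _).1 hT'
        exact ⟨hT.2 j, (hc j).2, (hc j).1⟩
      · rw [List.map_ofFn]
        exact (pairwise_ofFn_iff _).2 hT.1
      · rw [List.map_ofFn, digraph_node, compose_eq_listCompose]
        rfl
  · refine ⟨[T], by simp, ?_, by simp, ?_⟩
    · intro T' hT'
      obtain rfl := List.mem_singleton.1 hT'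
      exact ⟨hT, hc, hr⟩
    · simp [listCompose, binary_empty]

/-- Two or more parts are joined under a new root. A single part must be returned as it is, since
inner nodes have at least two children. -/
theorem HasParts.hasCanonicalTree {op : Op} {D : VDigraph V} (h : HasParts op D) :
    HasCanonicalTree D := by
  obtain ⟨l, hne, hl, hd, rfl⟩ := h
  obtain ⟨k, f, rfl⟩ : ∃ (k : ℕ) (f : Fin k → DiCoTree V), l = List.ofFn f :=
    ⟨_, l.get, (List.ofFn_get l).symm⟩
  rw [List.map_ofFn] at hd ⊢
  rw [pairwise_ofFn_iff] at hd
  match k, f with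
  | 0, f => simp at hne
  | 1, f =>
    obtain ⟨h1, h2, -⟩ := hl (f 0) (by simp)
    exact ⟨f 0, h1, h2, by simp [listCompose, binary_empty]⟩
  | k + 2, f =>
    have hf : ∀ j, (f j).IsVertexDisjoint ∧ (f j).IsCanonical ∧ (f j).rootOp ≠ some op :=
      fun j => hl (f j) ((List.mem_ofFn' _ _).2 ⟨j, rfl⟩)
    refine ⟨node op k f, ⟨hd, fun j => (hf j).1⟩, fun j => ⟨(hf j).2.2, (hf j).2.1⟩, ?_⟩
    rw [digraph_node, compose_eq_listCompose]
    rfl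

theorem HasParts.binary {op : Op} {D E : VDigraph V} (hD : HasParts op D) (hE : HasParts op E)
    (hDE : Disjoint D.verts E.verts) : HasParts op (binary op D E) := by
  obtain ⟨l, hne, hl, hd, rfl⟩ := hD
  obtain ⟨l', -, hl', hd', rfl⟩ := hE
  refine ⟨l ++ l', by simp [hne], ?_, ?_, ?_⟩
  · intro T hT
    exact (List.mem_append.1 hT).elim (hl T) (hl' T)
  · rw [List.map_append, List.pairwise_append]
    refine ⟨hd, hd', fun D hD E hE => hDE.mono ?_ ?_⟩
    · rw [verts_listCompose]
      exact fun v hv => ⟨D, hD, hv⟩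
    · rw [verts_listCompose]
      exact fun v hv => ⟨E, hE, hv⟩
  · rw [List.map_append, listCompose_append]

theorem HasParts.listCompose {op : Op} (l : List (VDigraph V)) (hne : l ≠ [])
    (hl : ∀ D ∈ l, HasParts op D) (hd : l.Pairwise (fun D E => Disjoint D.verts E.verts)) :
    HasParts op (listCompose op l) := by
  induction l with
  | nil => exact absurd rfl hne
  | cons D l ih =>
    rw [List.pairwise_cons] at hd
    by_cases h : l = []
    · subst h
      simpa [VDigraph.listCompose, binary_empty] using hl D (by simp)
    · refine (hl D (by simp)).binary (ih h (fun E hE => hl E (by simp [hE])) hd.2) ?_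
      rw [Set.disjoint_left]
      intro v hv hv'
      have : v ∈ (VDigraph.listCompose op l).verts := hv'
      rw [verts_listCompose] at this
      obtain ⟨E, hE, hvE⟩ := this
      exact Set.disjoint_left.1 (hd.1 E hE) hv hvE

theorem HasCanonicalTree.compose (op : Op) {k : ℕ} (hk : 1 ≤ k) {F : Fin k → VDigraph V}
    (hd : VertexDisjoint F) (hF : ∀ i, HasCanonicalTree (F i)) :
    HasCanonicalTree (compose op F) := by
  refine HasParts.hasCanonicalTree (op := op) ?_
  rw [compose_eq_listCompose]
  refine HasParts.listCompose _ ?_ ?_ ((pairwise_ofFn_iff _).2 hd)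
  · simp; omega
  · intro D hD
    obtain ⟨j, rfl⟩ := (List.mem_ofFn' _ _).1 hD
    exact (hF j).hasParts op

theorem hasCanonicalTree_of_isOrientedCograph {D : VDigraph V} (h : D.IsOrientedCograph) :
    HasCanonicalTree D := by
  induction h with
  | single v => exact ⟨leaf v, trivial, trivial, rfl⟩
  | disjointUnion hk F hd hF ih => exact HasCanonicalTree.compose Op.union hk hd ih
  | orderComposition hk F hd hF ih => exact HasCanonicalTree.compose Op.order hk hd ih

theorem exists_canonical {G : Digraph V} (h : OCG.IsOrientedCograph G) :
    ∃ T : DiCoTree V, T.IsDiCoTreeOf G ∧ T.IsCanonical := by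
  obtain ⟨T, h1, h2, h3⟩ := hasCanonicalTree_of_isOrientedCograph h
  exact ⟨T, ⟨h1, h3.symm⟩, h2⟩

end DiCoTree

end OCG

/-! ### Correctness and running time of Label -/

namespace OCG

variable {V : Type*}

namespace DiCoTree

open VDigraph

theorem isOrientedCograph_digraph {T : DiCoTree V} (h : T.IsVertexDisjoint) :
    T.digraph.IsOrientedCograph := by
  induction T with
  | leaf v => exact .single v
  | node op k child ih =>
    cases op
    · exact .disjointUnion (by omega) _ h.1 fun j => ih j (h.2 j)
    · exact .orderComposition (by omega) _ h.1 fun j => ih j (h.2 j)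

theorem verts_node (op : Op) (k : ℕ) (child : Fin (k + 2) → DiCoTree V) :
    (node op k child).digraph.verts = ⋃ j, (child j).digraph.verts := by
  cases op <;> rfl

theorem arc_node (op : Op) (k : ℕ) (child : Fin (k + 2) → DiCoTree V) (u v : V) :
    (node op k child).digraph.arc u v ↔ (∃ j, (child j).digraph.arc u v) ∨
      (op = Op.order ∧ ∃ a b, a < b ∧ u ∈ (child a).digraph.verts ∧
        v ∈ (child b).digraph.verts) := by
  cases op <;> simp [digraph, disjointUnion, orderComposition]

/-- What a call of Label with value `i` on the array `color` achieves on a tree for `D`. -/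
structure LabelSpec (D : VDigraph V) (i : ℕ) (color : V → ℕ) (r : LabelResult V) : Prop where
  le_out : i ≤ r.out
  color_mem : ∀ v ∈ D.verts, i ≤ r.color v ∧ r.color v ≤ r.out
  color_eq : ∀ v ∉ D.verts, r.color v = color v
  color_lt : ∀ u v, D.arc u v → r.color u < r.color v
  chain : ∃ S : Finset V, (∀ v ∈ S, v ∈ D.verts) ∧ S.card + i = r.out + 1 ∧
    ∀ u ∈ S, ∀ v ∈ S, u ≠ v → D.arc u v ∨ D.arc v u
  finite : D.verts.Finite
  steps_le : r.steps + 16 ≤ 21 * D.verts.ncard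

/-- The vertices of the first `j` children. -/
def prefixVerts {n : ℕ} (child : Fin n → DiCoTree V) (j : ℕ) : Set V :=
  {v | ∃ a : Fin n, (a : ℕ) < j ∧ v ∈ (child a).digraph.verts}

theorem prefixVerts_succ {n : ℕ} (child : Fin n → DiCoTree V) (j : Fin n) :
    prefixVerts child (j + 1) = prefixVerts child j ∪ (child j).digraph.verts := by
  ext v
  simp only [prefixVerts, Set.mem_ofPred_eq, Set.mem_union]
  constructor
  · rintro ⟨a, ha, hv⟩
    rcases Nat.lt_succ_iff_lt_or_eq.1 ha with h | h
    · exact .inl ⟨a, h, hv⟩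
    · obtain rfl := Fin.ext h
      exact .inr hv
  · rintro (⟨a, ha, hv⟩ | hv)
    · exact ⟨a, by omega, hv⟩
    · exact ⟨j, by omega, hv⟩

/-- The invariant of the loop of Label after the first `j` children of a node. -/
structure LoopInv (op : Op) {k : ℕ} (child : Fin (k + 2) → DiCoTree V) (i : ℕ) (color : V → ℕ)
    (j : ℕ) (s : LoopState V) : Prop where
  out_zero : j = 0 → s.out = 0 ∧ s.i = i
  le_out : 0 < j → i ≤ s.out
  next_union : op = Op.union → s.i = i
  next_order : op = Op.order → 0 < j → s.i = s.out + 1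
  color_mem : ∀ v ∈ prefixVerts child j, i ≤ s.color v ∧ s.color v ≤ s.out
  color_eq : ∀ v ∉ prefixVerts child j, s.color v = color v
  color_lt : ∀ a : Fin (k + 2), (a : ℕ) < j → ∀ u v, (child a).digraph.arc u v →
    s.color u < s.color v
  color_lt_order : op = Op.order → ∀ a b : Fin (k + 2), a < b → (b : ℕ) < j →
    ∀ u v, u ∈ (child a).digraph.verts → v ∈ (child b).digraph.verts → s.color u < s.color v
  chain : 0 < j → ∃ S : Finset V, (∀ v ∈ S, v ∈ prefixVerts child j) ∧ S.card + i = s.out + 1 ∧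
    ∀ u ∈ S, ∀ v ∈ S, u ≠ v → (node op k child).digraph.arc u v ∨ (node op k child).digraph.arc v u
  finite : (prefixVerts child j).Finite
  steps_le : s.steps + 10 * j ≤ 21 * (prefixVerts child j).ncard + 4

theorem LoopInv.init (op : Op) {k : ℕ} (child : Fin (k + 2) → DiCoTree V) (i : ℕ)
    (color : V → ℕ) : LoopInv op child i color 0 ⟨i, 0, color, 4⟩ := by
  have h : prefixVerts child 0 = ∅ := by simp [prefixVerts]
  constructor <;> simp [h]

theorem LoopInv.i_le {op : Op} {k : ℕ} {child : Fin (k + 2) → DiCoTree V} {i : ℕ}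
    {color : V → ℕ} {j : ℕ} {s : LoopState V} (h : LoopInv op child i color j s) : i ≤ s.i := by
  rcases Nat.eq_zero_or_pos j with hj | hj
  · exact (h.out_zero hj).2.ge
  · have := h.le_out hj
    cases op
    · exact (h.next_union rfl).ge
    · have := h.next_order rfl hj
      omega

/-- The child recolors only its own vertices, which are disjoint from the earlier ones, so
everything known about the earlier children persists. -/
theorem LoopInv.step {op : Op} {k : ℕ} {child : Fin (k + 2) → DiCoTree V} {i : ℕ} (hi : 1 ≤ i)
    (hd : VertexDisjoint fun j => (child j).digraph)
    (hv : ∀ j, (child j).IsVertexDisjoint)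
    {color : V → ℕ} {j : Fin (k + 2)} {s : LoopState V} (h : LoopInv op child i color j s)
    {r : LabelResult V} (hr : LabelSpec (child j).digraph s.i s.color r) :
    LoopInv op child i color (j + 1)
      { i := match (generalizing := false) op with
          | Op.union => i
          | Op.order => r.out + 1
        out := if s.out < r.out then r.out else s.out
        color := r.color
        steps := s.steps + r.steps + 6 } := by
  have hile := h.i_le
  have hle := hr.le_out
  have hdisj : ∀ v ∈ prefixVerts child j, v ∉ (child j).digraph.verts := by
    rintro v ⟨a, ha, hv⟩ hv'
    have := hd.eq_of_mem hv hv'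
    omega
  have hold : ∀ v ∈ prefixVerts child j, r.color v = s.color v := fun v hv =>
    hr.color_eq v (hdisj v hv)
  have hmax : s.out ≤ (if s.out < r.out then r.out else s.out) ∧
      r.out ≤ (if s.out < r.out then r.out else s.out) := by split_ifs <;> omega
  -- Under an order composition the running maximum is always the value just returned, so `out[v] +
  -- 1` is `out[u] + 1`. For the first child this uses that the initial value `0` lies below `i ≥
  -- 1`.
  have horder : op = Op.order → s.out < r.out := fun ho => by
    rcases Nat.eq_zero_or_pos (j : ℕ) with hj | hj
    · have := h.out_zero hj
      omega
    · have := h.next_order ho hj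
      omega
  have harc : ∀ u v, (child j).digraph.arc u v → (node op k child).digraph.arc u v :=
    fun u v huv => (arc_node ..).2 (.inl ⟨j, huv⟩)
  refine ⟨by omega, fun _ => ?_, ?_, ?_, ?_, ?_, ?_, ?_, fun _ => ?_, ?_, ?_⟩
  · dsimp only
    omega
  · rintro rfl; rfl
  · rintro rfl _
    have := horder rfl
    simp [this]
  · rw [prefixVerts_succ]
    rintro v (hv | hv)
    · have := h.color_mem v hv
      have := hold v hv
      dsimp only
      omega
    · have := hr.color_mem v hv
      dsimp only
      omega
  · rw [prefixVerts_succ]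
    intro v hv
    rw [Set.mem_union, not_or] at hv
    exact (hr.color_eq v hv.2).trans (h.color_eq v hv.1)
  · intro a ha u v huv
    rcases Nat.lt_succ_iff_lt_or_eq.1 ha with h' | h'
    · have hm := (isOrientedCograph_digraph (hv a)).mem_verts huv
      dsimp only
      rw [hold u ⟨a, h', hm.1⟩, hold v ⟨a, h', hm.2⟩]
      exact h.color_lt a h' u v huv
    · obtain rfl := Fin.ext h'
      exact hr.color_lt u v huv
  · intro ho a b hab hb u v hu hv
    have hab' : (a : ℕ) < b := hab
    rcases Nat.lt_succ_iff_lt_or_eq.1 hb with h' | h'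
    · dsimp only
      rw [hold u ⟨a, by omega, hu⟩, hold v ⟨b, h', hv⟩]
      exact h.color_lt_order ho a b hab h' u v hu hv
    · obtain rfl := Fin.ext h'
      have hu' : u ∈ prefixVerts child b := ⟨a, hab', hu⟩
      have h1 := h.color_mem u hu'
      have h2 := hr.color_mem v hv
      have h3 := h.next_order ho (by omega)
      have h4 := hold u hu'
      dsimp only
      omega
  · rw [prefixVerts_succ]
    obtain ⟨S, hS, hcard, hadj⟩ := hr.chain
    by_cases hlt : s.out < r.out
    · rw [if_pos hlt]
      -- For a later child of an order node the old and new cliques are joined; their sizes add up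
      -- because the child started at `s.out + 1`. Otherwise the child started at `i`, and its
      -- clique alone has the right size.
      by_cases hj : op = Op.order ∧ 0 < (j : ℕ)
      · obtain ⟨rfl, hj⟩ := hj
        obtain ⟨S', hS', hcard', hadj'⟩ := h.chain hj
        have hSS : Disjoint S' S := by
          rw [Finset.disjoint_left]
          exact fun v hv hv' => hdisj v (hS' v hv) (hS v hv')
        have hcross : ∀ u ∈ S', ∀ v ∈ S, (node Op.order k child).digraph.arc u v := by
          intro u hu v hv
          obtain ⟨a, ha, hua⟩ := hS' u hu
          exact (arc_node ..).2 (.inr ⟨rfl, a, j, ha, hua, hS v hv⟩)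
        refine ⟨S'.disjUnion S hSS, ?_, ?_, ?_⟩
        · intro v hv
          exact (Finset.mem_disjUnion.1 hv).imp (hS' v) (hS v)
        · have := h.next_order rfl hj
          rw [Finset.card_disjUnion]
          dsimp only
          omega
        · intro u hu v hv huv
          rcases Finset.mem_disjUnion.1 hu with hu | hu <;>
            rcases Finset.mem_disjUnion.1 hv with hv | hv
          · exact hadj' u hu v hv huv
          · exact .inl (hcross u hu v hv)
          · exact .inr (hcross v hv u hu)
          · exact (hadj u hu v hv huv).imp (harc _ _) (harc _ _)
      · have hsi : s.i = i := by
          cases op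
          · exact h.next_union rfl
          · simp only [true_and, not_lt, Nat.le_zero] at hj
            exact (h.out_zero hj).2
        refine ⟨S, fun v hv => .inr (hS v hv), by dsimp only; omega, fun u hu v hv huv => ?_⟩
        exact (hadj u hu v hv huv).imp (harc _ _) (harc _ _)
    -- The maximum is unchanged, so the old clique remains large enough. This is not the first
    -- child, for which `out[u]` is still `0`.
    · rw [if_neg hlt]
      have hj : 0 < (j : ℕ) := by
        by_contra hj
        have := h.out_zero (by omega)
        omega
      obtain ⟨S', hS', hcard', hadj'⟩ := h.chain hj
      exact ⟨S', fun v hv => .inl (hS' v hv), hcard', hadj'⟩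
  · rw [prefixVerts_succ]
    exact h.finite.union hr.finite
  · have h1 := h.steps_le
    have h2 := hr.steps_le
    rw [prefixVerts_succ, Set.ncard_union_eq (Set.disjoint_left.2 hdisj) h.finite hr.finite]
    dsimp only
    omega

theorem foldl_induction {α : Type*} {n : ℕ} (f : α → Fin n → α) (x : α) (P : ℕ → α → Prop)
    (h0 : P 0 x) (hs : ∀ (j : Fin n) (s : α), P j s → P (j + 1) (f s j)) :
    P n (Fin.foldl n f x) := by
  induction n with
  | zero => simpa using h0
  | succ n ih =>
    rw [Fin.foldl_succ_last]
    exact hs (Fin.last n) _ (ih (fun s j => f s j.castSucc) fun j s h => hs j.castSucc s h)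

/-- Quantifying over `i` and the old array makes the induction work, since each child is called with
the values left by its predecessors. -/
theorem label_spec [DecidableEq V] (T : DiCoTree V) (hT : T.IsVertexDisjoint) (i : ℕ) (hi : 1 ≤ i)
    (color : V → ℕ) : LabelSpec T.digraph i color (T.label i color) := by
  induction T generalizing i color with
  | leaf v =>
    constructor
    · exact le_rfl
    · rintro w rfl
      simp [label]
    · intro w hw
      exact Function.update_of_ne hw _ _
    · intro _ _ h
      exact h.elim
    · exact ⟨{v}, by simp [digraph, VDigraph.single], by simp [label]; omega, by
        simp +contextual⟩
    · exact Set.finite_singleton v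
    · simp [label, digraph, VDigraph.single]
  | node op k child ih =>
    have h := foldl_induction (n := k + 2)
      (fun (s : LoopState V) (v : Fin (k + 2)) =>
        { i := match (generalizing := false) op with
            | Op.union => i
            | Op.order => (label (child v) s.i s.color).out + 1
          out := if s.out < (label (child v) s.i s.color).out then
            (label (child v) s.i s.color).out else s.out
          color := (label (child v) s.i s.color).color
          steps := s.steps + (label (child v) s.i s.color).steps + 6 })
      ⟨i, 0, color, 4⟩ (LoopInv op child i color) (LoopInv.init op child i color)
      (fun j s h => h.step hi hT.1 hT.2 (ih j (hT.2 j) s.i (hi.trans h.i_le) s.color))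
    have hverts : prefixVerts child (k + 2) = (node op k child).digraph.verts := by
      rw [verts_node]
      ext v
      simp [prefixVerts]
    constructor
    · exact h.le_out (by omega)
    · rw [← hverts]; exact h.color_mem
    · rw [← hverts]; exact h.color_eq
    · intro u v huv
      rcases (arc_node ..).1 huv with ⟨j, hj⟩ | ⟨ho, a, b, hab, hu, hv⟩
      · exact h.color_lt j j.2 u v hj
      · exact h.color_lt_order ho a b hab b.2 u v hu hv
    · rw [← hverts]; exact h.chain (by omega)
    · rw [← hverts]; exact h.finite
    -- A leaf meets the bound with equality: `5 + 16 = 21`. At a node each child saves `16 - 6 = 10`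
    -- steps, and two children already pay for the initial `4` and the required `16`.
    · have : ((node op k child).label i color).steps + 10 * (k + 2) ≤
          21 * (prefixVerts child (k + 2)).ncard + 4 := h.steps_le
      rw [← hverts]
      omega

theorem label_correct [DecidableEq V] {G : Digraph V} {T : DiCoTree V} (hT : T.IsDiCoTreeOf G)
    (color : V → ℕ) :
    (T.label 1 color).out = orientedChromaticNumber G ∧
    IsOrientedColoring G (orientedChromaticNumber G) (T.label 1 color).color ∧
    (T.label 1 color).steps ≤ 21 * Nat.card V := by
  have h := label_spec T hT.1 1 le_rfl color
  rw [hT.2] at h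
  have hc : IsOrientedColoring G (T.label 1 color).out (T.label 1 color).color :=
    isOrientedColoring_of_strictMono (fun v => h.color_mem v trivial) h.color_lt
  obtain ⟨S, -, hcard, hadj⟩ := h.chain
  have heq := orientedChromaticNumber_eq hc S (by omega) hadj
  refine ⟨heq.symm, heq ▸ hc, ?_⟩
  have := h.steps_le
  rw [ofDigraph, Set.ncard_univ] at this
  omega

end DiCoTree

end OCG

namespace OCG

/-! Reasoning about programs. -/

/-- Started in state `s` at time `t`, program `p` halts in a state and at a time that satisfy
`Q`, on a machine with word bound `W`. -/
def WP (W : ℕ) (p : Program) (Q : State → ℕ → Prop) (s : State) (t : ℕ) : Prop :=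
  ∃ s' t', Exec W p s s' t' ∧ Q s' (t + t')

namespace WP

variable {W : ℕ} {p q : Program} {Q R : State → ℕ → Prop} {s : State} {t : ℕ} {r a b x : ℕ}

theorem mono (h : WP W p Q s t) (hQ : ∀ s t, Q s t → R s t) : WP W p R s t := by
  obtain ⟨s', t', he, hq⟩ := h
  exact ⟨s', t', he, hQ _ _ hq⟩

theorem seq (h : WP W p (WP W q Q) s t) : WP W (.seq p q) Q s t := by
  obtain ⟨s', t', he, s'', t'', he', hq⟩ := h
  exact ⟨s'', t' + t'', .seq he he', by rwa [← Nat.add_assoc]⟩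

theorem const (hx : x ≤ W) (h : Q (s.setReg r x) (t + 1)) : WP W (.const r x) Q s t :=
  ⟨_, _, .const s r x hx, h⟩

theorem copy (hx : s.reg a = x) (h : Q (s.setReg r x) (t + 1)) : WP W (.copy r a) Q s t :=
  ⟨_, _, .copy s r a, hx ▸ h⟩

theorem add (hx : s.reg a + s.reg b = x) (hW : x ≤ W) (h : Q (s.setReg r x) (t + 1)) :
    WP W (.add r a b) Q s t :=
  ⟨_, _, .add s r a b (hx ▸ hW), hx ▸ h⟩

theorem load (hx : s.mem (s.reg a) = x) (h : Q (s.setReg r x) (t + 1)) :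
    WP W (.load r a) Q s t :=
  ⟨_, _, .load s r a, hx ▸ h⟩

theorem store {y : ℕ} (hy : s.reg a = y) (hx : s.reg r = x) (h : Q (s.setMem y x) (t + 1)) :
    WP W (.store a r) Q s t :=
  ⟨_, _, .store s a r, hy ▸ hx ▸ h⟩

theorem ifLt (h : s.reg a < s.reg b → WP W p Q s (t + 1))
    (h' : ¬ s.reg a < s.reg b → WP W q Q s (t + 1)) : WP W (.ifLt a b p q) Q s t := by
  by_cases hab : s.reg a < s.reg b
  · obtain ⟨s', t', he, hq⟩ := h hab
    exact ⟨s', _, .ifLt_true hab he, by rwa [Nat.add_comm t', ← Nat.add_assoc]⟩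
  · obtain ⟨s', t', he, hq⟩ := h' hab
    exact ⟨s', _, .ifLt_false hab he, by rwa [Nat.add_comm t', ← Nat.add_assoc]⟩

/-- A loop with an invariant and a decreasing measure `k`. -/
theorem whileLt (I : ℕ → State → ℕ → Prop)
    (hI : ∀ k s t, I k s t → (¬ s.reg a < s.reg b ∧ Q s (t + 1)) ∨
      (s.reg a < s.reg b ∧ WP W p (fun s' t' => ∃ k' < k, I k' s' t') s (t + 1)))
    {k : ℕ} (h : I k s t) : WP W (.whileLt a b p) Q s t := by
  induction k using Nat.strong_induction_on generalizing s t with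
  | _ k ih =>
    rcases hI k s t h with ⟨hlt, hq⟩ | ⟨hlt, s', t', he, k', hk', hI'⟩
    · exact ⟨s, 1, .while_false hlt, hq⟩
    · obtain ⟨s'', t'', he', hq⟩ := ih k' hk' hI'
      refine ⟨s'', _, .while_true hlt he he', ?_⟩
      convert hq using 1
      omega

/-- A loop that is passed exactly `N` times. -/
theorem forLoop (I : ℕ → State → ℕ → Prop) (N : ℕ)
    (hI : ∀ k s t, k < N → I k s t → s.reg a < s.reg b ∧ WP W p (I (k + 1)) s (t + 1))
    (hN : ∀ s t, I N s t → ¬ s.reg a < s.reg b ∧ Q s (t + 1))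
    (h : I 0 s t) : WP W (.whileLt a b p) Q s t := by
  -- The measure is the number of passes still to come.
  refine whileLt (fun k s t => k ≤ N ∧ I (N - k) s t) ?_ (k := N) ⟨le_rfl, by simpa using h⟩
  rintro k s t ⟨hk, h⟩
  rcases Nat.eq_zero_or_pos k with rfl | hpos
  · exact .inl (hN s t h)
  · obtain ⟨h1, h2⟩ := hI (N - k) s t (by omega) h
    refine .inr ⟨h1, h2.mono fun s' t' h' => ⟨k - 1, by omega, by omega, ?_⟩⟩
    rwa [show N - (k - 1) = N - k + 1 by omega]

end WP

theorem State.reg_setReg (s : State) (r x a : ℕ) :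
    (s.setReg r x).reg a = if a = r then x else s.reg a := by
  simp [State.setReg, Function.update_apply]

theorem State.mem_setReg (s : State) (r x : ℕ) : (s.setReg r x).mem = s.mem := rfl

theorem State.reg_setMem (s : State) (y x : ℕ) : (s.setMem y x).reg = s.reg := rfl

theorem State.mem_setMem (s : State) (y x a : ℕ) :
    (s.setMem y x).mem a = if a = y then x else s.mem a := by
  simp [State.setMem, Function.update_apply]

/-! The program. -/

/-- The registers that stay fixed: `2` holds `n`; `3`, `4`, `1`, `5` hold the addresses of the
arrays of in-degrees, buckets, colors, and links; `6`, `7`, `8` hold the numbers `1`, `0`, `2`. -/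
structure FixedRegs (n m : ℕ) (s : State) : Prop where
  r1 : s.reg 1 = 2 * m + 2 + 2 * n
  r2 : s.reg 2 = n
  r3 : s.reg 3 = 2 * m + 2
  r4 : s.reg 4 = 2 * m + 2 + n
  r5 : s.reg 5 = 2 * m + 2 + 3 * n
  r6 : s.reg 6 = 1
  r7 : s.reg 7 = 0
  r8 : s.reg 8 = 2

theorem FixedRegs.setReg {n m : ℕ} {s : State} (h : FixedRegs n m s) {r : ℕ} (x : ℕ)
    (hr : r = 0 ∨ 9 ≤ r) : FixedRegs n m (s.setReg r x) := by
  obtain ⟨h1, h2, h3, h4, h5, h6, h7, h8⟩ := h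
  constructor <;> rw [State.reg_setReg, if_neg (by omega)] <;> assumption

theorem FixedRegs.setMem {n m : ℕ} {s : State} (h : FixedRegs n m s) (y x : ℕ) :
    FixedRegs n m (s.setMem y x) :=
  ⟨h.1, h.2, h.3, h.4, h.5, h.6, h.7, h.8⟩

/-- The contents of the memory: the arcs `(tl e, hd e)`, and the arrays of in-degrees, buckets,
colors, and links; the links are indexed by the addresses of the arcs. -/
structure Layout (n m : ℕ) (tl hd ind bkt col nxt : ℕ → ℕ) (mem : ℕ → ℕ) : Prop where
  tl : ∀ e < m, mem (2 * e + 2) = tl e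
  hd : ∀ e < m, mem (2 * e + 3) = hd e
  ind : ∀ v < n, mem (2 * m + 2 + v) = ind v
  bkt : ∀ d < n, mem (2 * m + 2 + n + d) = bkt d
  col : ∀ v < n, mem (2 * m + 2 + 2 * n + v) = col v
  nxt : ∀ e < m, mem (2 * m + 2 + 3 * n + (2 * e + 2)) = nxt e

namespace Layout

variable {n m : ℕ} {tl hd ind bkt col nxt : ℕ → ℕ} {s : State}

/-- The arrays occupy disjoint blocks, so a write to one leaves the others alone. The new contents
are described pointwise and only within range, so that any convenient closed form can be supplied.
-/
theorem setInd (h : Layout n m tl hd ind bkt col nxt s.mem) {v x : ℕ} (hv : v < n)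
    {ind' : ℕ → ℕ} (hind : ∀ w < n, ind' w = if w = v then x else ind w) :
    Layout n m tl hd ind' bkt col nxt (s.setMem (2 * m + 2 + v) x).mem := by
  constructor
  · intro e he
    rw [State.mem_setMem, if_neg (by omega), h.tl e he]
  · intro e he
    rw [State.mem_setMem, if_neg (by omega), h.hd e he]
  · intro w hw
    rw [State.mem_setMem, hind w hw, h.ind w hw]
    simp
  · intro e he
    rw [State.mem_setMem, if_neg (by omega), h.bkt e he]
  · intro e he
    rw [State.mem_setMem, if_neg (by omega), h.col e he]
  · intro e he
    rw [State.mem_setMem, if_neg (by omega), h.nxt e he]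

theorem setBkt (h : Layout n m tl hd ind bkt col nxt s.mem) {v x : ℕ} (hv : v < n)
    {bkt' : ℕ → ℕ} (hbkt : ∀ w < n, bkt' w = if w = v then x else bkt w) :
    Layout n m tl hd ind bkt' col nxt (s.setMem (2 * m + 2 + n + v) x).mem := by
  constructor
  · intro e he
    rw [State.mem_setMem, if_neg (by omega), h.tl e he]
  · intro e he
    rw [State.mem_setMem, if_neg (by omega), h.hd e he]
  · intro e he
    rw [State.mem_setMem, if_neg (by omega), h.ind e he]
  · intro w hw
    rw [State.mem_setMem, hbkt w hw, h.bkt w hw]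
    simp
  · intro e he
    rw [State.mem_setMem, if_neg (by omega), h.col e he]
  · intro e he
    rw [State.mem_setMem, if_neg (by omega), h.nxt e he]

theorem setCol (h : Layout n m tl hd ind bkt col nxt s.mem) {v x : ℕ} (hv : v < n)
    {col' : ℕ → ℕ} (hcol : ∀ w < n, col' w = if w = v then x else col w) :
    Layout n m tl hd ind bkt col' nxt (s.setMem (2 * m + 2 + 2 * n + v) x).mem := by
  constructor
  · intro e he
    rw [State.mem_setMem, if_neg (by omega), h.tl e he]
  · intro e he
    rw [State.mem_setMem, if_neg (by omega), h.hd e he]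
  · intro e he
    rw [State.mem_setMem, if_neg (by omega), h.ind e he]
  · intro e he
    rw [State.mem_setMem, if_neg (by omega), h.bkt e he]
  · intro w hw
    rw [State.mem_setMem, hcol w hw, h.col w hw]
    simp
  · intro e he
    rw [State.mem_setMem, if_neg (by omega), h.nxt e he]

/-- The link array is the last block, so no bound on the index is needed to protect the other
arrays. -/
theorem setNxt (h : Layout n m tl hd ind bkt col nxt s.mem) {v x : ℕ}
    {nxt' : ℕ → ℕ} (hnxt : ∀ w < m, nxt' w = if w = v then x else nxt w) :
    Layout n m tl hd ind bkt col nxt' (s.setMem (2 * m + 2 + 3 * n + (2 * v + 2)) x).mem := by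
  constructor
  · intro e he
    rw [State.mem_setMem, if_neg (by omega), h.tl e he]
  · intro e he
    rw [State.mem_setMem, if_neg (by omega), h.hd e he]
  · intro e he
    rw [State.mem_setMem, if_neg (by omega), h.ind e he]
  · intro e he
    rw [State.mem_setMem, if_neg (by omega), h.bkt e he]
  · intro e he
    rw [State.mem_setMem, if_neg (by omega), h.col e he]
  · intro w hw
    rw [State.mem_setMem, hnxt w hw, h.nxt w hw]
    simp

end Layout

local infixr:60 " ;; " => Program.seq

/-- Compute the fixed registers. -/
def setupProg : Program :=
  .const 6 1 ;; .const 8 2 ;; .load 2 7 ;; .load 3 6 ;; .add 3 3 3 ;; .add 3 3 8 ;;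
  .add 4 3 2 ;; .add 1 4 2 ;; .add 5 1 2

/-- Give every vertex the color `1`. -/
def colorProg : Program :=
  .copy 9 7 ;; .whileLt 9 2 (.add 10 1 9 ;; .store 10 6 ;; .add 9 9 6)

/-- Compute the in-degrees. -/
def indegreeProg : Program :=
  .copy 9 8 ;; .whileLt 9 3
    (.add 10 9 6 ;; .load 10 10 ;; .add 10 3 10 ;; .load 11 10 ;; .add 11 11 6 ;; .store 10 11 ;;
      .add 9 9 8)

/-- Sort the arcs into linked lists, according to the in-degree of the tail. -/
def bucketProg : Program :=
  .copy 9 8 ;; .whileLt 9 3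
    (.load 10 9 ;; .add 10 3 10 ;; .load 10 10 ;; .add 10 4 10 ;; .load 11 10 ;; .add 12 5 9 ;;
      .store 12 11 ;; .store 10 9 ;; .add 9 9 8)

/-- Treat the arc at the address in register `10`: raise the color of its head above the color of
its tail, update the maximum in register `0`, and go to the next arc of the list. -/
def arcProg : Program :=
  .load 11 10 ;; .add 12 10 6 ;; .load 12 12 ;; .add 11 1 11 ;; .load 11 11 ;; .add 11 11 6 ;;
  .add 12 1 12 ;; .load 13 12 ;;
  .ifLt 13 11 (.store 12 11 ;; .ifLt 0 11 (.copy 0 11) (.copy 0 0)) (.copy 0 0) ;;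
  .add 10 5 10 ;; .load 10 10

/-- Treat the arcs in the order of the in-degrees of their tails. -/
def relaxProg : Program :=
  .copy 0 6 ;; .copy 9 7 ;; .whileLt 9 2
    (.add 10 4 9 ;; .load 10 10 ;; .whileLt 7 10 arcProg ;; .add 9 9 6)

/-- Compute an optimal oriented coloring of an oriented co-graph. -/
def coloringProg : Program :=
  setupProg ;; colorProg ;; indegreeProg ;; bucketProg ;; relaxProg

/-! ### Correctness of setup, in-degree count and bucket sort -/

section

variable {n m W : ℕ} {tl hd : ℕ → ℕ} {Q : State → ℕ → Prop} {s : State} {t : ℕ}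

/-- Register `7` is never written: its initial `0` serves as a constant and as the address of `n`.
The largest address in use is `3 * n + 4 * m + 2`, which `7 * (n + m)` covers because `n ≥ 1`. -/
theorem wp_setupProg (hW : 7 * (n + m) ≤ W) (hn : 1 ≤ n)
    (hs : s.reg 7 = 0) (h0 : s.mem 0 = n) (h1 : s.mem 1 = m)
    (htl : ∀ e < m, s.mem (2 * e + 2) = tl e) (hhd : ∀ e < m, s.mem (2 * e + 3) = hd e)
    (hz : ∀ a, 2 * m + 2 ≤ a → s.mem a = 0)
    (hQ : ∀ s', FixedRegs n m s' →
      Layout n m tl hd (fun _ => 0) (fun _ => 0) (fun _ => 0) (fun _ => 0) s'.mem →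
      Q s' (t + 9)) : WP W setupProg Q s t := by
  refine .seq <| .const (by omega) <| .seq <| .const (by omega) <|
    .seq <| .load (x := n) (by simp [State.reg_setReg, State.mem_setReg, hs, h0]) <|
    .seq <| .load (x := m) (by simp [State.reg_setReg, State.mem_setReg, h1]) <|
    .seq <| .add (x := m + m) (by simp [State.reg_setReg]) (by omega) <|
    .seq <| .add (x := 2 * m + 2) (by simp [State.reg_setReg]; omega) (by omega) <|
    .seq <| .add (x := 2 * m + 2 + n) (by simp [State.reg_setReg]) (by omega) <|
    .seq <| .add (x := 2 * m + 2 + 2 * n) (by simp [State.reg_setReg]; omega) (by omega) <|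
    .add (x := 2 * m + 2 + 3 * n) (by simp [State.reg_setReg]; omega) (by omega) <|
    hQ _ ?_ ?_
  · constructor <;> simp [State.reg_setReg, hs]
  · simp only [State.mem_setReg]
    exact ⟨htl, hhd, fun _ _ => hz _ (by omega), fun _ _ => hz _ (by omega),
      fun _ _ => hz _ (by omega), fun _ _ => hz _ (by omega)⟩

theorem wp_colorProg (hW : 7 * (n + m) ≤ W) (hn : 1 ≤ n) (hs : FixedRegs n m s)
    {ind bkt nxt : ℕ → ℕ} (hm : Layout n m tl hd ind bkt (fun _ => 0) nxt s.mem)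
    (hQ : ∀ s' t', FixedRegs n m s' → Layout n m tl hd ind bkt (fun _ => 1) nxt s'.mem →
      t' ≤ t + 2 + 4 * n → Q s' t') : WP W colorProg Q s t := by
  refine .seq <| .copy (x := 0) hs.r7 <| .forLoop (fun k s t' => FixedRegs n m s ∧ s.reg 9 = k ∧
    Layout n m tl hd ind bkt (fun v => if v < k then 1 else 0) nxt s.mem ∧ t' ≤ t + 1 + 4 * k)
    n ?_ ?_ ⟨hs.setReg _ (by omega), by simp [State.reg_setReg], by simpa [State.mem_setReg] using hm,
      by omega⟩
  · rintro k s t' hk ⟨hs, h9, hm, ht⟩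
    refine ⟨by rwa [h9, hs.r2], ?_⟩
    refine .seq <| .add (x := 2 * m + 2 + 2 * n + k) (by rw [hs.r1, h9]) (by omega) <|
      .seq <| .store (y := 2 * m + 2 + 2 * n + k) (x := 1) (by simp [State.reg_setReg])
        (by simp [State.reg_setReg, hs.r6]) <|
      .add (x := k + 1) (by simp [State.reg_setReg, State.reg_setMem, hs.r6, h9]) (by omega)
      ⟨((hs.setReg _ (by omega)).setMem _ _).setReg _ (by omega), by simp [State.reg_setReg],
        ?_, by omega⟩
    rw [State.mem_setReg]
    refine Layout.setCol (s := s.setReg _ _) hm hk fun w _ => ?_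
    split_ifs <;> omega
  · rintro s t' ⟨hs, h9, hm, ht⟩
    refine ⟨by rw [h9, hs.r2]; omega, hQ _ _ hs ⟨hm.tl, hm.hd, hm.ind, hm.bkt, ?_, hm.nxt⟩
      (by omega)⟩
    intro v hv
    rw [hm.col v hv, if_pos hv]

theorem wp_indegreeProg (hW : 7 * (n + m) ≤ W) (hn : 1 ≤ n) (hs : FixedRegs n m s)
    (hhd : ∀ e < m, hd e < n)
    {bkt col nxt : ℕ → ℕ} (hm : Layout n m tl hd (fun _ => 0) bkt col nxt s.mem)
    (hQ : ∀ s' t', FixedRegs n m s' →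
      Layout n m tl hd (fun v => Nat.count (fun e => hd e = v) m) bkt col nxt s'.mem →
      t' ≤ t + 2 + 8 * m → Q s' t') : WP W indegreeProg Q s t := by
  -- The counter runs through the arc addresses `2, 4, …`; register `3` holds both their end and the
  -- base of the in-degree array.
  refine .seq <| .copy (x := 2) hs.r8 <| .forLoop (fun k s t' => FixedRegs n m s ∧
    s.reg 9 = 2 * k + 2 ∧
    Layout n m tl hd (fun v => Nat.count (fun e => hd e = v) k) bkt col nxt s.mem ∧
    t' ≤ t + 1 + 8 * k)
    m ?_ ?_ ⟨hs.setReg _ (by omega), by simp [State.reg_setReg], by simpa [State.mem_setReg] using hm,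
      by omega⟩
  · rintro k s t' hk ⟨hs, h9, hm, ht⟩
    refine ⟨by rw [h9, hs.r3]; omega, ?_⟩
    have hc : Nat.count (fun e => hd e = hd k) k ≤ k := Nat.count_le _
    have hk' := hhd k hk
    refine .seq <| .add (x := 2 * k + 3) (by rw [hs.r6, h9]) (by omega) <|
      .seq <| .load (x := hd k) (by simp [State.reg_setReg, State.mem_setReg, hm.hd k hk]) <|
      .seq <| .add (x := 2 * m + 2 + hd k) (by simp [State.reg_setReg, hs.r3]) (by omega) <|
      .seq <| .load (x := Nat.count (fun e => hd e = hd k) k)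
        (by simp [State.reg_setReg, State.mem_setReg, hm.ind _ hk']) <|
      .seq <| .add (x := Nat.count (fun e => hd e = hd k) k + 1)
        (by simp [State.reg_setReg, hs.r6]) (by omega) <|
      .seq <| .store (y := 2 * m + 2 + hd k) (x := Nat.count (fun e => hd e = hd k) k + 1)
        (by simp [State.reg_setReg]) (by simp [State.reg_setReg]) <|
      .add (x := 2 * (k + 1) + 2)
        (by simp [State.reg_setReg, State.reg_setMem, hs.r8, h9]; omega) (by omega)
      ⟨?_, by simp [State.reg_setReg], ?_, by omega⟩
    · exact ((((((hs.setReg _ (by omega)).setReg _ (by omega)).setReg _ (by omega)).setReg _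
        (by omega)).setReg _ (by omega)).setMem _ _).setReg _ (by omega)
    · rw [State.mem_setReg]
      refine Layout.setInd (ind := fun v => Nat.count (fun e => hd e = v) k) ?_ hk' fun w _ => ?_
      · simpa only [State.mem_setReg] using hm
      · simp only [Nat.count_succ]
        by_cases h : w = hd k
        · subst h; simp
        · simp [h, Ne.symm h]
  · rintro s t' ⟨hs, h9, hm, ht⟩
    exact ⟨by rw [h9, hs.r3]; omega, hQ _ _ hs hm (by omega)⟩

/-- The address of the last one of the first `k` arcs that has key `d`, or `0`. -/
def lastArc (key : ℕ → ℕ) : ℕ → ℕ → ℕ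
  | 0, _ => 0
  | k + 1, d => if d = key k then 2 * k + 2 else lastArc key k d

/-- Describes one move along a bucket's list: either no arc of key `d` is left below `k`, or the
next one is the largest such `k'`. Arc addresses are at least `2`, so `0` can mark the end of a
list. -/
theorem lastArc_cases (key : ℕ → ℕ) (k d : ℕ) :
    (lastArc key k d = 0 ∧ ∀ e < k, key e ≠ d) ∨
    ∃ k' < k, key k' = d ∧ lastArc key k d = 2 * k' + 2 ∧ ∀ e < k, k' < e → key e ≠ d := by
  induction k with
  | zero => simp [lastArc]
  | succ k ih =>
    by_cases hk : d = key k
    · exact .inr ⟨k, by omega, hk.symm, by rw [lastArc, if_pos hk], by omega⟩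
    · rw [lastArc, if_neg hk]
      rcases ih with ⟨h1, h2⟩ | ⟨k', h1, h2, h3, h4⟩
      · refine .inl ⟨h1, fun e he => ?_⟩
        rcases Nat.lt_succ_iff_lt_or_eq.1 he with h | rfl
        · exact h2 e h
        · exact fun h => hk h.symm
      · refine .inr ⟨k', by omega, h2, h3, fun e he hk' => ?_⟩
        rcases Nat.lt_succ_iff_lt_or_eq.1 he with h | rfl
        · exact h4 e h hk'
        · exact fun h => hk h.symm

/-- Every arc is pushed onto the front of its bucket, so its link is the bucket's previous head, and
each list runs through its arcs in decreasing number. -/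
theorem wp_bucketProg (hW : 7 * (n + m) ≤ W) (hn : 1 ≤ n) (hs : FixedRegs n m s)
    (htl : ∀ e < m, tl e < n) {ind col : ℕ → ℕ} (hind : ∀ v < n, ind v < n)
    (hm : Layout n m tl hd ind (fun _ => 0) col (fun _ => 0) s.mem)
    (hQ : ∀ s' t', FixedRegs n m s' →
      Layout n m tl hd ind (lastArc (fun e => ind (tl e)) m) col
        (fun e => lastArc (fun e => ind (tl e)) e (ind (tl e))) s'.mem →
      t' ≤ t + 2 + 10 * m → Q s' t') : WP W bucketProg Q s t := by
  set key := fun e => ind (tl e) with hkey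
  refine .seq <| .copy (x := 2) hs.r8 <| .forLoop (fun k s t' => FixedRegs n m s ∧
    s.reg 9 = 2 * k + 2 ∧
    Layout n m tl hd ind (lastArc key k) col (fun e => if e < k then lastArc key e (key e) else 0)
      s.mem ∧
    t' ≤ t + 1 + 10 * k)
    m ?_ ?_ ⟨hs.setReg _ (by omega), by simp [State.reg_setReg], ?_, by omega⟩
  · rintro k s t' hk ⟨hs, h9, hm, ht⟩
    refine ⟨by rw [h9, hs.r3]; omega, ?_⟩
    have htk := htl k hk
    have hik : key k < n := hind _ htk
    refine .seq <| .load (x := tl k) (by rw [h9, hm.tl k hk]) <|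
      .seq <| .add (x := 2 * m + 2 + tl k) (by simp [State.reg_setReg, hs.r3]) (by omega) <|
      .seq <| .load (x := key k) (by simp [State.reg_setReg, State.mem_setReg, hm.ind _ htk, hkey]) <|
      .seq <| .add (x := 2 * m + 2 + n + key k) (by simp [State.reg_setReg, hs.r4]) (by omega) <|
      .seq <| .load (x := lastArc key k (key k))
        (by simp [State.reg_setReg, State.mem_setReg, hm.bkt _ hik]) <|
      .seq <| .add (x := 2 * m + 2 + 3 * n + (2 * k + 2))
        (by simp [State.reg_setReg, hs.r5, h9]) (by omega) <|
      .seq <| .store (y := 2 * m + 2 + 3 * n + (2 * k + 2)) (x := lastArc key k (key k))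
        (by simp [State.reg_setReg]) (by simp [State.reg_setReg]) <|
      .seq <| .store (y := 2 * m + 2 + n + key k) (x := 2 * k + 2)
        (by simp [State.reg_setReg, State.reg_setMem])
        (by simp [State.reg_setReg, State.reg_setMem, h9]) <|
      .add (x := 2 * (k + 1) + 2)
        (by simp [State.reg_setReg, State.reg_setMem, hs.r8, h9]; omega) (by omega)
      ⟨?_, by simp [State.reg_setReg], ?_, by omega⟩
    · exact ((((((((hs.setReg _ (by omega)).setReg _ (by omega)).setReg _ (by omega)).setReg _
        (by omega)).setReg _ (by omega)).setReg _ (by omega)).setMem _ _).setMem _ _).setReg _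
        (by omega)
    · rw [State.mem_setReg]
      -- The recursion defining `lastArc` is exactly this push onto the front.
      refine Layout.setBkt (bkt := lastArc key k) ?_ hik fun w _ => rfl
      refine Layout.setNxt (nxt := fun e => if e < k then lastArc key e (key e) else 0) ?_
        fun w _ => ?_
      · simpa only [State.mem_setReg] using hm
      · by_cases h : w = k
        · subst h; simp
        · simp only [if_neg h]
          split_ifs <;> omega
  · rintro s t' ⟨hs, h9, hm, ht⟩
    refine ⟨by rw [h9, hs.r3]; omega, hQ _ _ hs ⟨hm.tl, hm.hd, hm.ind, hm.bkt, hm.col, ?_⟩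
      (by omega)⟩
    intro e he
    rw [hm.nxt e he, if_pos he]
  · rw [State.mem_setReg]
    exact ⟨hm.tl, hm.hd, hm.ind, hm.bkt, hm.col, hm.nxt⟩

end

end OCG

/-! ### Treating the arcs in the order of the in-degrees of their tails -/

namespace OCG

/-- The state of the coloring `f` after the arcs in `S` have been treated: `f` increases along
these arcs, `f v` is the size of a clique of vertices before `v`, and `r` is the maximum of `f`. -/
structure Relaxed {n : ℕ} (G : Digraph (Fin n)) (f : ℕ → ℕ) (S : Fin n → Fin n → Prop) (r : ℕ) :
    Prop where
  lt : ∀ u v, S u v → f u < f v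
  chain : ∀ v : Fin n, ∃ A : Finset (Fin n), v ∈ A ∧ A.card = f v ∧
    (∀ x ∈ A, ∀ y ∈ A, x ≠ y → G.Adj x y ∨ G.Adj y x) ∧ ∀ x ∈ A, x ≠ v → G.Adj x v
  le : ∀ v : Fin n, f v ≤ r
  attained : ∃ v : Fin n, f v = r

namespace Relaxed

variable {n : ℕ} {G : Digraph (Fin n)} {f : ℕ → ℕ} {S S' : Fin n → Fin n → Prop} {r : ℕ}

theorem init (hn : 1 ≤ n) (hS : ∀ u v, ¬ S u v) : Relaxed G (fun _ => 1) S 1 where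
  lt u v h := (hS u v h).elim
  chain v := ⟨{v}, by simp, by simp, by simp +contextual, by simp⟩
  le _ := le_rfl
  attained := ⟨⟨0, hn⟩, rfl⟩

/-- Colors are sizes of cliques; this keeps them within the word bound. -/
theorem le_card (h : Relaxed G f S r) (v : Fin n) : f v ≤ n := by
  obtain ⟨A, -, hA, -⟩ := h.chain v
  simpa [hA] using Finset.card_le_univ A

theorem keep (h : Relaxed G f S r) {u v : Fin n} (hS : ∀ a b, S' a b → S a b ∨ (a = u ∧ b = v))
    (huv : f u < f v) : Relaxed G f S' r := by
  refine ⟨fun a b hab => ?_, h.chain, h.le, h.attained⟩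
  rcases hS a b hab with hab | ⟨rfl, rfl⟩
  · exact h.lt a b hab
  · exact huv

/-- Since `v` is the tail of no treated arc, raising `f v` cannot break an inequality. By
transitivity all of the clique ending at `u` precedes `v`, so adding `v` gives a clique of size `f u
+ 1`. -/
theorem raise (h : Relaxed G f S r) (hirr : ∀ u, ¬ G.Adj u u)
    (htr : ∀ u v w, G.Adj u v → G.Adj v w → G.Adj u w) {u v : Fin n} (huv : G.Adj u v)
    (hS : ∀ a b, S' a b → S a b ∨ (a = u ∧ b = v)) (hv : ∀ w, ¬ S' v w) (hle : f v ≤ f u) :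
    Relaxed G (Function.update f v (f u + 1)) S' (max r (f u + 1)) := by
  have hne : ∀ w : Fin n, w ≠ v → Function.update f v (f u + 1) w = f w := fun w hw =>
    Function.update_of_ne (fun hw' => hw (Fin.ext hw')) _ _
  have hself : Function.update f v (f u + 1) v = f u + 1 := Function.update_self ..
  have hge : ∀ w : Fin n, f w ≤ Function.update f v (f u + 1) w := fun w => by
    by_cases hw : w = v
    · subst hw; omega
    · exact (hne w hw).ge
  have huv' : u ≠ v := fun h => hirr u (by rwa [← h] at huv)
  refine ⟨fun a b hab => ?_, fun w => ?_, fun w => ?_, ?_⟩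
  · have hav : a ≠ v := fun h => hv b (h ▸ hab)
    rw [hne a hav]
    rcases hS a b hab with hab | ⟨rfl, rfl⟩
    · exact (h.lt a b hab).trans_le (hge b)
    · omega
  · by_cases hw : w = v
    · subst hw
      obtain ⟨A, huA, hcard, hadj, hA⟩ := h.chain u
      have hAw : ∀ x ∈ A, G.Adj x w := fun x hx => by
        by_cases hxu : x = u
        · exact hxu ▸ huv
        · exact htr _ _ _ (hA x hx hxu) huv
      have hwA : w ∉ A := fun hw => hirr w (hAw w hw)
      refine ⟨insert w A, Finset.mem_insert_self _ _, ?_, ?_, ?_⟩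
      · rw [Finset.card_insert_of_notMem hwA, hcard, hself]
      · intro x hx y hy hxy
        rcases Finset.mem_insert.1 hx with hx' | hx' <;>
          rcases Finset.mem_insert.1 hy with hy' | hy'
        · exact absurd (hx'.trans hy'.symm) hxy
        · exact .inr (hx' ▸ hAw y hy')
        · exact .inl (hy' ▸ hAw x hx')
        · exact hadj x hx' y hy' hxy
      · intro x hx hxw
        exact hAw x ((Finset.mem_insert.1 hx).resolve_left hxw)
    · rw [hne w hw]
      exact h.chain w
  · by_cases hw : w = v
    · subst hw; rw [hself]; exact le_max_right _ _
    · rw [hne w hw]; exact (h.le w).trans (le_max_left _ _)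
  · by_cases hr : r < f u + 1
    · exact ⟨v, by rw [hself, max_eq_right hr.le]⟩
    · obtain ⟨w, hw⟩ := h.attained
      refine ⟨w, ?_⟩
      rw [hne w (by rintro rfl; omega), max_eq_left (by omega), hw]

end Relaxed

/-- The arcs that have been treated when the arcs with key less than `d`, and those with key `d`
and number at least `k`, have been treated. -/
def treated (m : ℕ) (key : ℕ → ℕ) (d k : ℕ) : Finset ℕ :=
  {e ∈ Finset.range m | key e < d ∨ (key e = d ∧ k ≤ e)}

theorem mem_treated {m : ℕ} {key : ℕ → ℕ} {d k e : ℕ} :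
    e ∈ treated m key d k ↔ e < m ∧ (key e < d ∨ (key e = d ∧ k ≤ e)) := by
  simp [treated]

/-- The arcs with numbers in `E` as a relation on the vertices. -/
def arcsOf {n : ℕ} (tl hd : ℕ → ℕ) (E : Finset ℕ) (u v : Fin n) : Prop :=
  ∃ e ∈ E, tl e = u ∧ hd e = v

/-- The three branches realize `Relaxed.raise` with or without a new maximum, and `Relaxed.keep`.
Copying register `0` to itself acts as the empty instruction. -/
theorem wp_arcProg {n m W : ℕ} {tl hd : ℕ → ℕ} {G : Digraph (Fin n)}
    (hW : 7 * (n + m) ≤ W) (hn : 1 ≤ n) (hirr : ∀ u, ¬ G.Adj u u)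
    (htr : ∀ u v w, G.Adj u v → G.Adj v w → G.Adj u w)
    {s : State} {t : ℕ} {Q : State → ℕ → Prop} (hs : FixedRegs n m s)
    {ind bkt nxt f : ℕ → ℕ} (hm : Layout n m tl hd ind bkt f nxt s.mem)
    {S S' : Fin n → Fin n → Prop} (hf : Relaxed G f S (s.reg 0))
    {e : ℕ} (he : e < m) (h10 : s.reg 10 = 2 * e + 2)
    {u v : Fin n} (hu : tl e = u) (hv : hd e = v) (huv : G.Adj u v)
    (hS : ∀ a b, S' a b → S a b ∨ (a = u ∧ b = v)) (hS' : ∀ w, ¬ S' v w)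
    (hQ : ∀ s' t' f', FixedRegs n m s' → Layout n m tl hd ind bkt f' nxt s'.mem →
      s'.reg 9 = s.reg 9 → s'.reg 10 = nxt e → Relaxed G f' S' (s'.reg 0) → t' ≤ t + 14 → Q s' t') :
    WP W arcProg Q s t := by
  have hfu := hf.le_card u
  refine .seq <| .load (x := u) (by rw [h10, hm.tl e he, hu]) <|
    .seq <| .add (x := 2 * e + 3) (by simp [State.reg_setReg, h10, hs.r6]) (by omega) <|
    .seq <| .load (x := v) (by simp [State.reg_setReg, State.mem_setReg, hm.hd e he, hv]) <|
    .seq <| .add (x := 2 * m + 2 + 2 * n + u) (by simp [State.reg_setReg, hs.r1]) (by omega) <|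
    .seq <| .load (x := f u)
      (by simp [State.reg_setReg, State.mem_setReg, hm.col u u.2]) <|
    .seq <| .add (x := f u + 1) (by simp [State.reg_setReg, hs.r6]) (by omega) <|
    .seq <| .add (x := 2 * m + 2 + 2 * n + v) (by simp [State.reg_setReg, hs.r1]) (by omega) <|
    .seq <| .load (x := f v)
      (by simp [State.reg_setReg, State.mem_setReg, hm.col v v.2]) <|
    .seq <| ?_
  set s₁ := (((((((s.setReg 11 u).setReg 12 (2 * e + 3)).setReg 12 v).setReg 11
    (2 * m + 2 + 2 * n + u)).setReg 11 (f u)).setReg 11 (f u + 1)).setReg 12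
    (2 * m + 2 + 2 * n + v)).setReg 13 (f v) with hs₁
  have hf₁ : FixedRegs n m s₁ := (((((((hs.setReg _ (by omega)).setReg _ (by omega)).setReg _
    (by omega)).setReg _ (by omega)).setReg _ (by omega)).setReg _ (by omega)).setReg _
    (by omega)).setReg _ (by omega)
  have hm₁ : Layout n m tl hd ind bkt f nxt s₁.mem := by
    simpa only [hs₁, State.mem_setReg] using hm
  have h0 : s₁.reg 0 = s.reg 0 := by simp [hs₁, State.reg_setReg]
  have h9 : s₁.reg 9 = s.reg 9 := by simp [hs₁, State.reg_setReg]
  have h10₁ : s₁.reg 10 = 2 * e + 2 := by simp [hs₁, State.reg_setReg, h10]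
  have h11 : s₁.reg 11 = f u + 1 := by simp [hs₁, State.reg_setReg]
  have h12 : s₁.reg 12 = 2 * m + 2 + 2 * n + v := by simp [hs₁, State.reg_setReg]
  have h13 : s₁.reg 13 = f v := by simp [hs₁, State.reg_setReg]
  -- The common ending of all branches: follow the link to the next arc.
  have key : ∀ s' t' f', FixedRegs n m s' → Layout n m tl hd ind bkt f' nxt s'.mem →
      s'.reg 9 = s.reg 9 → s'.reg 10 = 2 * e + 2 → Relaxed G f' S' (s'.reg 0) → t' ≤ t + 12 →
      WP W (Program.seq (.add 10 5 10) (.load 10 10)) Q s' t' := by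
    intro s' t' f' hs' hm' h9' h10' hf' ht'
    refine .seq <| .add (x := 2 * m + 2 + 3 * n + (2 * e + 2)) (by rw [hs'.r5, h10']) (by omega) <|
      .load (x := nxt e) (by simp [State.reg_setReg, State.mem_setReg, hm'.nxt e he]) <|
      hQ _ _ f' ((hs'.setReg _ (by omega)).setReg _ (by omega)) hm' ?_ ?_ ?_ (by omega)
    · simpa [State.reg_setReg] using h9'
    · simp [State.reg_setReg]
    · simpa [State.reg_setReg] using hf'
  clear_value s₁
  refine .ifLt (fun hlt => ?_) (fun hlt => ?_)
  · rw [h11, h13] at hlt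
    have hr := hf.raise hirr htr huv hS hS' (by omega)
    refine .seq <| .store h12 h11 ?_
    have hm₂ : Layout n m tl hd ind bkt (Function.update f v (f u + 1)) nxt
        (s₁.setMem (2 * m + 2 + 2 * n + v) (f u + 1)).mem :=
      hm₁.setCol v.2 fun w _ => by rw [Function.update_apply]
    have hf₂ := hf₁.setMem (2 * m + 2 + 2 * n + v) (f u + 1)
    refine .ifLt (fun hlt' => ?_) (fun hlt' => ?_)
    · rw [State.reg_setMem, h0, h11] at hlt'
      refine .copy (x := f u + 1) h11 <| key _ _ _ (hf₂.setReg _ (by omega)) hm₂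
        (by simp [State.reg_setReg, State.reg_setMem, h9])
        (by simp [State.reg_setReg, State.reg_setMem, h10₁]) ?_ (by omega)
      rw [max_eq_right hlt'.le] at hr
      simpa [State.reg_setReg] using hr
    · rw [State.reg_setMem, h0, h11] at hlt'
      refine .copy (x := s.reg 0) h0 <| key _ _ _ (hf₂.setReg _ (by omega)) hm₂
        (by simp [State.reg_setReg, State.reg_setMem, h9])
        (by simp [State.reg_setReg, State.reg_setMem, h10₁]) ?_ (by omega)
      rw [max_eq_left (by omega)] at hr
      simpa [State.reg_setReg] using hr
  · rw [h11, h13] at hlt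
    refine .copy (x := s.reg 0) h0 <| key _ _ _ (hf₁.setReg _ (by omega)) hm₁
      (by simp [State.reg_setReg, h9]) (by simp [State.reg_setReg, h10₁]) ?_ (by omega)
    have hr := hf.keep hS (by omega)
    simpa [State.reg_setReg] using hr

theorem wp_relaxProg {n m W : ℕ} {tl hd : ℕ → ℕ} {G : Digraph (Fin n)}
    (hW : 7 * (n + m) ≤ W) (hn : 1 ≤ n) (hirr : ∀ u, ¬ G.Adj u u)
    (htr : ∀ u v w, G.Adj u v → G.Adj v w → G.Adj u w)
    {ind : ℕ → ℕ} (hind : ∀ v < n, ind v < n)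
    (harc : ∀ e < m, ∃ u v : Fin n, tl e = u ∧ hd e = v ∧ G.Adj u v)
    (hinc : ∀ e < m, ind (tl e) < ind (hd e))
    {s : State} {t : ℕ} {Q : State → ℕ → Prop} (hs : FixedRegs n m s)
    (hm : Layout n m tl hd ind (lastArc (fun e => ind (tl e)) m) (fun _ => 1)
        (fun e => lastArc (fun e => ind (tl e)) e (ind (tl e))) s.mem)
    (hQ : ∀ s' t' f, FixedRegs n m s' → (∀ v < n, s'.mem (2 * m + 2 + 2 * n + v) = f v) →
      Relaxed G f (arcsOf tl hd (Finset.range m)) (s'.reg 0) →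
      t' ≤ t + 3 + 5 * n + 15 * m → Q s' t') :
    WP W relaxProg Q s t := by
  set key := fun e => ind (tl e) with hkey
  have htl : ∀ e < m, tl e < n := fun e he => by
    obtain ⟨u, v, hu, -⟩ := harc e he
    rw [hu]
    exact u.2
  refine .seq <| .copy (x := 1) hs.r6 <| .seq <| .copy (x := 0) (by simp [State.reg_setReg, hs.r7]) <|
    -- A bucket costs two loop tests and three instructions, an arc one test and at most `14` steps.
    -- No arc has number `m` or more, so `treated m key d m` contains no arc of key `d`.
    .forLoop (fun d s t' => FixedRegs n m s ∧ s.reg 9 = d ∧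
      t' ≤ t + 2 + 5 * d + 15 * (treated m key d m).card ∧
      ∃ f, Layout n m tl hd ind (lastArc key m) f (fun e => lastArc key e (key e)) s.mem ∧
        Relaxed G f (arcsOf tl hd (treated m key d m)) (s.reg 0)) n ?_ ?_
      ⟨(hs.setReg _ (by omega)).setReg _ (by omega), by simp [State.reg_setReg], by omega, _, hm, ?_⟩
  · rintro d s t' hd' ⟨hs, h9, ht, f, hm, hf⟩
    refine ⟨by rwa [h9, hs.r2], ?_⟩
    refine .seq <| .add (x := 2 * m + 2 + n + d) (by rw [hs.r4, h9]) (by omega) <|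
      .seq <| .load (x := lastArc key m d)
        (by simp [State.reg_setReg, State.mem_setReg, hm.bkt d hd']) <|
      -- The measure `k` is also the position in the list: the arcs of this bucket numbered `k` or
      -- more are done. Each pass drops to the next smaller number in the bucket, not by one.
      .seq <| .whileLt (k := m) (fun k s t' => k ≤ m ∧ FixedRegs n m s ∧ s.reg 9 = d ∧
        s.reg 10 = lastArc key k d ∧ t' ≤ t + 2 + 5 * d + 3 + 15 * (treated m key d k).card ∧
        ∃ f, Layout n m tl hd ind (lastArc key m) f (fun e => lastArc key e (key e)) s.mem ∧
          Relaxed G f (arcsOf tl hd (treated m key d k)) (s.reg 0)) ?_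
      ⟨le_rfl, (hs.setReg _ (by omega)).setReg _ (by omega), by simp [State.reg_setReg, h9],
        by simp [State.reg_setReg], by omega, f, hm, by simpa [State.reg_setReg] using hf⟩
    clear ht hm hf h9 hs
    rintro k s t' ⟨hk, hs, h9, h10, ht, f, hm, hf⟩
    rcases lastArc_cases key k d with ⟨h0, hno⟩ | ⟨k', hk', hkey', h0, hno⟩
    -- The list is exhausted, so the whole bucket has been treated.
    · have hset : treated m key d k = treated m key (d + 1) m := by
        ext e
        rw [mem_treated, mem_treated]
        have := hno e
        omega
      refine .inl ⟨by rw [hs.r7, h10]; omega, ?_⟩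
      rw [hset] at ht hf
      exact .add (x := d + 1) (by rw [h9, hs.r6]) (by omega)
        ⟨hs.setReg _ (by omega), by simp [State.reg_setReg], by omega, f, hm,
          by simpa [State.reg_setReg] using hf⟩
    · refine .inr ⟨by rw [hs.r7, h10]; omega, ?_⟩
      have hset : treated m key d k' = insert k' (treated m key d k) := by
        ext e
        rw [Finset.mem_insert, mem_treated, mem_treated]
        have := hno e
        constructor
        · intro h
          by_cases h' : e = k' <;> by_cases h'' : k ≤ e <;> omega
        · rintro (rfl | h) <;> omega
      have hnot : k' ∉ treated m key d k := by
        rw [mem_treated]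
        omega
      obtain ⟨u, v, hu, hv, huv⟩ := harc k' (by omega)
      refine wp_arcProg hW hn hirr htr hs hm hf (e := k') (by omega) (by rw [h10, h0]) hu hv huv
        (S' := arcsOf tl hd (treated m key d k')) ?_ ?_ ?_
      · rintro a b ⟨e, he, ha, hb⟩
        rw [hset, Finset.mem_insert] at he
        rcases he with rfl | he
        · exact .inr ⟨Fin.ext (ha.symm.trans hu), Fin.ext (hb.symm.trans hv)⟩
        · exact .inl ⟨e, he, ha, hb⟩
      -- A treated arc leaving the head of `k'` would have key `ind (hd k')`, which exceeds `d`,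
      -- whereas treated arcs have keys at most `d`.
      · rintro w ⟨e, he, ha, -⟩
        rw [mem_treated] at he
        have := hinc k' (by omega)
        have h1 : key e = ind (hd k') := by rw [hv, ← ha]
        have h2 : key k' = ind (tl k') := rfl
        omega
      · intro s' t'' f' hs' hm' h9' h10' hf' ht'
        refine ⟨k', hk', by omega, hs', by rw [h9', h9], by rw [h10', hkey'], ?_, f', hm', hf'⟩
        rw [hset, Finset.card_insert_of_notMem hnot]
        omega
  · rintro s t' ⟨hs, h9, ht, f, hm, hf⟩
    refine ⟨by rw [h9, hs.r2]; omega, ?_⟩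
    have hset : treated m key n m = Finset.range m := by
      ext e
      rw [mem_treated, Finset.mem_range]
      refine ⟨fun h => h.1, fun h => ⟨h, .inl (hind _ (htl e h))⟩⟩
    rw [hset] at ht hf
    rw [Finset.card_range] at ht
    exact hQ _ _ f hs hm.col hf (by omega)
  · refine Relaxed.init hn ?_
    rintro u v ⟨e, he, -⟩
    rw [mem_treated] at he
    omega

end OCG

/-! ### From the input encoding to the final bound -/

namespace OCG

theorem getD_flatMap_pair {n : ℕ} (L : List (Fin n × Fin n)) (a : ℕ) :
    (L.flatMap fun e => [(e.1 : ℕ), (e.2 : ℕ)]).getD (2 * a) 0 = (L.map fun e => (e.1 : ℕ)).getD a 0 ∧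
    (L.flatMap fun e => [(e.1 : ℕ), (e.2 : ℕ)]).getD (2 * a + 1) 0 =
      (L.map fun e => (e.2 : ℕ)).getD a 0 := by
  induction L generalizing a with
  | nil => simp
  | cons x L ih =>
    cases a with
    | zero => simp
    | succ a => simpa [Nat.mul_succ] using ih a

/-- The number of in-neighbors, counted in a list of the arcs. -/
theorem count_head_eq {n : ℕ} {G : Digraph (Fin n)} {L : List (Fin n × Fin n)}
    (hL : ListsArcs G L) (v : Fin n) :
    Nat.count (fun e => (L.map fun e => (e.2 : ℕ)).getD e 0 = v) L.length =
      Set.ncard {w | G.Adj w v} := by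
  classical
  rw [Nat.count_eq_card_filter_range, Set.ncard_eq_toFinset_card']
  refine Finset.card_bij (fun e he => (L[e]'(by simp at he; exact he.1)).1) ?_ ?_ ?_
  · intro e he
    rw [Finset.mem_filter, Finset.mem_range] at he
    obtain ⟨he, hev⟩ := he
    rw [List.getD_eq_getElem _ _ (by simpa using he), List.getElem_map] at hev
    have := (hL.2 L[e].1 L[e].2).1 (List.getElem_mem he)
    rw [Fin.ext hev] at this
    simpa using this
  · intro e he e' he' h
    rw [Finset.mem_filter, Finset.mem_range] at he he'
    obtain ⟨he, hev⟩ := he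
    obtain ⟨he', hev'⟩ := he'
    rw [List.getD_eq_getElem _ _ (by simpa using he), List.getElem_map] at hev
    rw [List.getD_eq_getElem _ _ (by simpa using he'), List.getElem_map] at hev'
    exact (hL.1.getElem_inj_iff).1 (Prod.ext h (Fin.ext (hev.trans hev'.symm)))
  · intro w hw
    have hw : G.Adj w v := by simpa using hw
    obtain ⟨e, he, hev⟩ := List.getElem_of_mem ((hL.2 w v).2 hw)
    refine ⟨e, ?_, by rw [hev]⟩
    rw [Finset.mem_filter, Finset.mem_range, List.getD_eq_getElem _ _ (by simpa using he),
      List.getElem_map, hev]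
    exact ⟨he, rfl⟩

/-- The phases take at most `18 + 9 * n + 33 * m` steps in total, and `n ≥ 1` absorbs the constant;
this sum dictates the factor `33`. -/
theorem computesOptimalColoring_coloringProg {n : ℕ} {G : Digraph (Fin n)}
    (hG : IsOrientedCograph G) {L : List (Fin n × Fin n)} (hL : ListsArcs G L) :
    ComputesOptimalColoring coloringProg G L (33 * (n + L.length)) := by
  have hirr : ∀ u, ¬ G.Adj u u := VDigraph.IsOrientedCograph.irrefl hG
  have htr : ∀ u v w, G.Adj u v → G.Adj v w → G.Adj u w := fun u v w =>
    VDigraph.IsOrientedCograph.trans hG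
  have hn : 1 ≤ n := by
    obtain ⟨v, -⟩ := VDigraph.IsOrientedCograph.nonempty hG
    exact v.pos
  set m := L.length with hm
  set tl : ℕ → ℕ := fun e => (L.map fun e => (e.1 : ℕ)).getD e 0 with htl
  set hd : ℕ → ℕ := fun e => (L.map fun e => (e.2 : ℕ)).getD e 0 with hhd
  have htl' : ∀ e (he : e < m), tl e = L[e].1 := fun e he => by
    rw [htl]
    dsimp only
    rw [List.getD_eq_getElem _ _ (by simpa using he), List.getElem_map]
  have hhd' : ∀ e (he : e < m), hd e = L[e].2 := fun e he => by
    rw [hhd]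
    dsimp only
    rw [List.getD_eq_getElem _ _ (by simpa using he), List.getElem_map]
  have hadj : ∀ e (he : e < m), G.Adj L[e].1 L[e].2 := fun e he =>
    (hL.2 _ _).1 (List.getElem_mem he)
  have hcount : ∀ v : Fin n, Nat.count (fun e => hd e = v) m = Set.ncard {w | G.Adj w v} :=
    count_head_eq hL
  -- No vertex is its own in-neighbor, so `n` buckets suffice.
  have hind : ∀ v < n, Nat.count (fun e => hd e = v) m < n := fun v hv => by
    have h : Set.ncard {w | G.Adj w ⟨v, hv⟩} < (Set.univ : Set (Fin n)).ncard :=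
      Set.ncard_lt_ncard ⟨Set.subset_univ _, fun h => hirr ⟨v, hv⟩ (h (Set.mem_univ _))⟩
        (Set.toFinite _)
    rw [← hcount ⟨v, hv⟩, Set.ncard_univ, Nat.card_fin] at h
    exact h
  -- In-neighbors of the tail are in-neighbors of the head by transitivity; the tail itself makes
  -- the inclusion strict.
  have hinc : ∀ e < m, Nat.count (fun e' => hd e' = tl e) m <
      Nat.count (fun e' => hd e' = hd e) m := fun e he => by
    rw [htl' e he, hhd' e he, hcount, hcount]
    exact Set.ncard_lt_ncard ⟨fun w hw => htr _ _ _ hw (hadj e he), fun h =>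
      hirr _ (h (hadj e he))⟩ (Set.toFinite _)
  have hmem : ∀ a, (inputState L).mem (a + 2) =
      (L.flatMap fun e => [(e.1 : ℕ), (e.2 : ℕ)]).getD a 0 := fun a => by
    simp [inputState, encodeInput]
  have hzero : ∀ a, 2 * m + 2 ≤ a → (inputState L).mem a = 0 := fun a ha => by
    obtain ⟨b, rfl⟩ := Nat.exists_eq_add_of_le' (show 2 ≤ a by omega)
    rw [hmem]
    refine List.getD_eq_default _ _ ?_
    simp [List.length_flatMap]
    omega
  suffices h : WP (33 * (n + m)) coloringProg (fun s t => t ≤ 33 * (n + m) ∧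
      s.reg 0 = orientedChromaticNumber G ∧
      IsOrientedColoring G (orientedChromaticNumber G) fun v => s.mem (s.reg 1 + (v : ℕ)))
      (inputState L) 0 by
    obtain ⟨s, t, he, h1, h2, h3⟩ := h
    exact ⟨s, t, he, by omega, h2, h3⟩
  refine .seq <| wp_setupProg (n := n) (m := m) (tl := tl) (hd := hd) (by omega) hn rfl rfl rfl
    (fun e _ => (hmem _).trans (getD_flatMap_pair L e).1)
    (fun e _ => (hmem _).trans (getD_flatMap_pair L e).2) hzero fun s hs hm => ?_
  refine .seq <| wp_colorProg (by omega) hn hs hm fun s t hs hm ht => ?_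
  refine .seq <| wp_indegreeProg (by omega) hn hs (fun e he => by rw [hhd' e he]; exact Fin.is_lt _)
    hm fun s t hs hm ht => ?_
  refine .seq <| wp_bucketProg (by omega) hn hs (fun e he => by rw [htl' e he]; exact Fin.is_lt _)
    hind hm fun s t hs hm ht => ?_
  refine wp_relaxProg (by omega) hn hirr htr hind
    (fun e he => ⟨L[e].1, L[e].2, htl' e he, hhd' e he, hadj e he⟩) hinc hs hm
    fun s t f hs hcol hf ht => ⟨by omega, ?_⟩
  have hlt : ∀ u v, G.Adj u v → f u < f v := fun u v huv => by
    obtain ⟨e, he, hev⟩ := List.getElem_of_mem ((hL.2 u v).2 huv)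
    exact hf.lt u v ⟨e, Finset.mem_range.2 he, by rw [htl' e he, hev], by rw [hhd' e he, hev]⟩
  have hc : IsOrientedColoring G (s.reg 0) fun v => f v :=
    isOrientedColoring_of_strictMono (fun v => ⟨by
      obtain ⟨A, hvA, hA, -⟩ := hf.chain v
      rw [← hA]
      exact Finset.card_pos.2 ⟨v, hvA⟩, hf.le v⟩) hlt
  obtain ⟨v, hv⟩ := hf.attained
  obtain ⟨A, -, hA, hAdj, -⟩ := hf.chain v
  have heq := orientedChromaticNumber_eq hc A (hA.trans hv) hAdj
  refine ⟨heq.symm, ?_⟩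
  rw [heq, hs.r1]
  convert hc using 2 with v
  exact hcol v v.2

end OCG

theorem mainTheorem1 :
    (∃ (P : OCG.Program) (C : ℕ), ∀ (n : ℕ) (G : Digraph (Fin n)), OCG.IsOrientedCograph G →
      ∀ L : List (Fin n × Fin n), OCG.ListsArcs G L →
        OCG.ComputesOptimalColoring P G L (C * (n + L.length))) ∧
    (∃ C : ℕ, ∀ (V : Type*) [DecidableEq V] (G : Digraph V), OCG.IsOrientedCograph G →
      (∃ T : OCG.DiCoTree V, T.IsDiCoTreeOf G ∧ T.IsCanonical) ∧
      ∀ T : OCG.DiCoTree V, T.IsDiCoTreeOf G → T.IsCanonical → ∀ color₀ : V → ℕ,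
        (T.label 1 color₀).out = OCG.orientedChromaticNumber G ∧
        OCG.IsOrientedColoring G (OCG.orientedChromaticNumber G) (T.label 1 color₀).color ∧
        (T.label 1 color₀).steps ≤ C * Nat.card V) := by
  refine ⟨⟨OCG.coloringProg, 33, fun n G hG L hL =>
    OCG.computesOptimalColoring_coloringProg hG hL⟩, 21, fun V _ G hG =>
    ⟨OCG.DiCoTree.exists_canonical hG, fun T hT _ color₀ => OCG.DiCoTree.label_correct hT color₀⟩⟩
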